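/- Let $\mathcal X$ be a separable real Hilbert space (of infinite or finite dimension) with orthonormal basis $(e_i)_{i\in I}$, let $C$ be a symmetric, positive (semi-definite), trace class operator on $\mathcal X$, and let $N_C$ be the centred Gaussian measure on $\mathcal X$ with covariance operator $C$. Let $U\colon\mathcal X\to\mathbb R$ be Fréchet differentiable with gradient $DU$, and let $P,Q$ be Borel probability measures on $\mathcal X$ with $P\propto e^{-U}N_C$ such that $$\mathbb E_Q\|X\|^2<\infty,\quad \mathbb E_Q\|C\,DU(X)\|<\infty,\quad e^{-U/2}\in W^{1,2}_C(\mathcal X),\quad \mathbb E_{N_C}\|C^{1/2}DU(X)\|^2<\infty,$$ where $W^{1,2}_C(\mathcal X)$ is the Malliavin–Sobolev space, i.e. the closure of the smooth cylinder functions in $L^2(N_C)$ under the norm $(\|f\|^2_{L^2(N_C)}+\|C^{1/2}Df\|^2_{L^2(N_C)})^{1/2}$. Let $k\colon\mathcal X\times\mathcal X\to\mathbb R$ be a symmetric positive definite kernel with reproducing kernel Hilbert space $\mathcal H_k$, and let $\mathcal H_K$ be the reproducing kernel Hilbert space of $\mathcal X$-valued functions with operator-valued kernel $K=k\,I_{\mathcal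 X}$. Write $k\in C_b^{(\alpha,\alpha)}$ if the partial Fréchet derivatives $D_1^iD_2^jk$, $0\le i,j\le\alpha$, exist and are continuous and bounded on $\mathcal X\times\mathcal X$. Put $$\mathcal A f(x)=\mathrm{Tr}[C D^2f(x)]-\langle Df(x),x+C\,DU(x)\rangle,\qquad \mathcal A_vF(x)=\mathrm{Tr}[C\,DF(x)]-\langle F(x),x+C\,DU(x)\rangle,$$ $$\Gamma_i f(x)=\langle C\,Df(x)-f(x)(x+C\,DU(x)),e_i\rangle,$$ $$\mathrm{KSD}_{\mathcal A,k}(Q,P)=\sup_{f\in\mathcal H_k,\|f\|_k\le1}|\mathbb E_Q[\mathcal Af(X)]|,\qquad \mathrm{KSD}_{\mathcal A_v,K}(Q,P)=\sup_{F\in\mathcal H_K,\|F\|_K\le1}|\mathbb E_Q[\mathcal A_vF(X)]|,$$ and for an operator $A$ let $(A\otimes A)k(x,x')$ denote the result of applying $A$ to $k$ in each of its two arguments. (a) If $k\in C_b^{(2,2)}$, then every $f\in\mathcal H_k$ is twice continuously differentiable with $\mathcal A f$ $Q$-integrable; for every $x'$ the function obtained by applying $\mathcal A$ to $k$ in its second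 argument at $x'$ is twice continuously differentiable in the first argument; $\mathrm{KSD}_{\mathcal A,k}(Q,P)$ is finite, $(\mathcal A\otimes\mathcal A)k$ is $Q\times Q$-integrable, and $$\mathrm{KSD}_{\mathcal A,k}(Q,P)^2=\mathbb E_{(X,X')\sim Q\times Q}[(\mathcal A\otimes\mathcal A)k(X,X')].$$ (b) If $k\in C_b^{(1,1)}$, then every $F\in\mathcal H_K$ is differentiable with $\mathcal A_vF$ $Q$-integrable; for every $i$ and $x'$ the function obtained by applying $\Gamma_i$ to $k$ in its second argument at $x'$ is differentiable in the first argument; $\mathrm{KSD}_{\mathcal A_v,K}(Q,P)$ is finite, each $(\Gamma_i\otimes\Gamma_i)k$ is $Q\times Q$-integrable, the series $\sum_i(\Gamma_i\otimes\Gamma_i)k(x,x')$ converges for all $x,x'$, and $$\mathrm{KSD}_{\mathcal A_v,K}(Q,P)^2=\sum_{i\in I}\mathbb E_{(X,X')\sim Q\times Q}[(\Gamma_i\otimes\Gamma_i)k(X,X')].$$ Hence in both cases the squared KSD can be estimated from samples of $Q$ only: with $h=(\mathcal A\otimes\mathcal A)k$ in (a) and $h=\sum_i(\Gamma_i\otimes\Gamma_i)k$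 in (b), and $X_1,\dots,X_n$ i.i.d. from $Q$, $n\ge2$, the $U$-statistic $\frac1{n(n-1)}\sum_{i\ne j}h(X_i,X_j)$ is integrable and is an unbiased estimator of the squared KSD. -/

import Mathlib

open MeasureTheory ProbabilityTheory Filter Topology
open scoped RealInnerProductSpace ENNReal

noncomputable section

section Operators

variable {X : Type*} [NormedAddCommGroup X] [InnerProductSpace ℝ X] [CompleteSpace X]

/-- Trace of a bounded operator: `∑ ⟨T bᵢ, bᵢ⟩` over a (chosen) orthonormal basis of `X`.
It is only used for operators of the form `C ∘ B` with `C` trace class and `B` bounded, for which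
the sum converges absolutely and does not depend on the basis. -/
def opTrace (T : X →L[ℝ] X) : ℝ :=
  ∑' i, ⟪T ((exists_hilbertBasis ℝ X).choose_spec.choose i),
    (exists_hilbertBasis ℝ X).choose_spec.choose i⟫

/-- `C ∈ L₁⁺(X)`: symmetric, positive (semi-definite) and trace class. For a positive operator
trace class means that `∑ ⟨C bᵢ, bᵢ⟩ < ∞` in orthonormal bases. -/
structure IsPosTraceClass (C : X →L[ℝ] X) : Prop where
  isPositive : C.IsPositive
  summable : ∀ (w : Set X) (b : HilbertBasis w ℝ X), Summable fun i => ⟪C (b i), b i⟫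

/-- The Stein operator `𝒜 f (x) = Tr[C D²f(x)] - ⟨Df(x), x + C DU(x)⟩`. By Riesz, `Df(x)` is
`gradient f x`, and `D²f(x)`, as an operator on `X`, is the derivative of the gradient. -/
def steinOp (C : X →L[ℝ] X) (U : X → ℝ) (f : X → ℝ) (x : X) : ℝ :=
  opTrace (C ∘L fderiv ℝ (gradient f) x) - ⟪gradient f x, x + C (gradient U x)⟫

/-- The vectorised Stein operator `𝒜ᵥ F (x) = Tr[C DF(x)] - ⟨F(x), x + C DU(x)⟩`. -/
def vecSteinOp (C : X →L[ℝ] X) (U : X → ℝ) (F : X → X) (x : X) : ℝ :=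
  opTrace (C ∘L fderiv ℝ F x) - ⟪F x, x + C (gradient U x)⟫

/-- `Γ f (x) = C Df(x) - f(x) (x + C DU(x))`. -/
def gammaOp (C : X →L[ℝ] X) (U : X → ℝ) (f : X → ℝ) (x : X) : X :=
  C (gradient f x) - f x • (x + C (gradient U x))

/-- The component `⟨Γ f (x), u⟩` of `Γ f (x)` along `u`; `Γᵢ` is the case `u = eᵢ`. -/
def gammaComp (C : X →L[ℝ] X) (U : X → ℝ) (u : X) (f : X → ℝ) (x : X) : ℝ :=
  ⟪gammaOp C U f x, u⟫

/-- `(A ⊗ A) k (x, x')`: the operator `A` is applied to `k` in each of its two arguments. -/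
def tensorOp (A : (X → ℝ) → X → ℝ) (k : X → X → ℝ) (x x' : X) : ℝ :=
  A (fun z => A (fun z' => k z z') x') x

end Operators

section Kernels

variable {X : Type*} [NormedAddCommGroup X] [InnerProductSpace ℝ X]

/-- The mixed partial Fréchet derivative `D₁ⁱ D₂ʲ F (x, y)`. -/
def mixedDeriv (i j : ℕ) (F : X → X → ℝ) (x y : X) :
    ContinuousMultilinearMap ℝ (fun _ : Fin i => X)
      (ContinuousMultilinearMap ℝ (fun _ : Fin j => X) ℝ) :=
  iteratedFDeriv ℝ i (fun x' => iteratedFDeriv ℝ j (F x') y) x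

/-- `F ∈ C_b^{(α,α)}(X × X)`: the partial derivatives `D₁ⁱ D₂ʲ F`, `i, j ≤ α`, exist, are jointly
continuous and are bounded. (Existence is expressed by `ContDiff`; the continuity of each
derivative in one argument that this contains is part of the joint continuity.) -/
structure IsCb (α : ℕ) (F : X → X → ℝ) : Prop where
  contDiff_snd : ∀ x, ContDiff ℝ α (F x)
  contDiff_fst : ∀ j ≤ α, ∀ y, ContDiff ℝ α (fun x => iteratedFDeriv ℝ j (F x) y)
  continuous : ∀ i ≤ α, ∀ j ≤ α, Continuous fun p : X × X => mixedDeriv i j F p.1 p.2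
  bounded : ∀ i ≤ α, ∀ j ≤ α, ∃ M : ℝ, ∀ x y, ‖mixedDeriv i j F x y‖ ≤ M

/-- `H` is the reproducing kernel Hilbert space of `V`-valued functions on `X` with kernel
`(x, y) ↦ k(x, y) • id_V`. For `V = ℝ` this is `H_k`, for `V = X` it is `H_K` with `K = k I_X`.
Such an `H` exists exactly when `k` is symmetric and positive definite
(the converse construction is `RKHS.OfKernel`), and it is unique as a Hilbert space of functions. -/
def HasScalarKernel {V : Type*} [NormedAddCommGroup V] [InnerProductSpace ℝ V] [CompleteSpace V]
    (H : Type*) [NormedAddCommGroup H] [InnerProductSpace ℝ H] [CompleteSpace H] [RKHS ℝ H X V]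
    (k : X → X → ℝ) : Prop :=
  ∀ x y, RKHS.kernel H x y = k x y • ContinuousLinearMap.id ℝ V

/-- Kernel Stein discrepancy for the operator `A` on the Hilbert space of functions `H`:
the supremum of `|E_Q[A f(X)]|` over the unit ball of `H`, in `[0, ∞]`. -/
def ksd {V : Type*} [NormedAddCommGroup V] [InnerProductSpace ℝ V] [MeasurableSpace X]
    (H : Type*) [NormedAddCommGroup H] [InnerProductSpace ℝ H] [RKHS ℝ H X V]
    (A : (X → V) → X → ℝ) (Q : Measure X) : ℝ≥0∞ :=
  ⨆ f : H, ⨆ _ : ‖f‖ ≤ 1, ENNReal.ofReal |∫ x, A (⇑f) x ∂Q|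

end Kernels

section Measures

variable {X : Type*} [NormedAddCommGroup X] [InnerProductSpace ℝ X] [MeasurableSpace X]

/-- `γ = N_C`, the centred Gaussian measure with covariance operator `C`: the law of `⟨y, ·⟩` is
`N(0, ⟨C y, y⟩)` for every `y`. -/
def IsCenteredGaussian (C : X →L[ℝ] X) (γ : Measure X) : Prop :=
  ∀ y : X, γ.map (fun x => ⟪y, x⟫) = gaussianReal 0 ⟪C y, y⟫.toNNReal

/-- Smooth cylinder functions `x ↦ φ(⟨l₁, x⟩, …, ⟨lₙ, x⟩)`, with `φ ∈ C_b^∞(ℝⁿ)`. -/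
def IsSmoothCylinder (f : X → ℝ) : Prop :=
  ∃ (n : ℕ) (l : Fin n → X) (φ : (Fin n → ℝ) → ℝ), ContDiff ℝ ((⊤ : ℕ∞) : WithTop ℕ∞) φ ∧
    (∀ m : ℕ, ∃ M : ℝ, ∀ z, ‖iteratedFDeriv ℝ m φ z‖ ≤ M) ∧ f = fun x => φ fun i => ⟪l i, x⟫

variable [CompleteSpace X]

/-- `f ∈ W_C^{1,2}(X)`, the Malliavin–Sobolev space of `γ = N_C`: `f` is the `L²`-limit of smooth
cylinder functions `gₙ` whose Malliavin derivatives `C^{1/2} D gₙ` converge (are Cauchy) in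
`L²(X, X; γ)`. Here `‖C^{1/2} v‖² = ⟨C v, v⟩`. -/
def MemMalliavinSobolev (C : X →L[ℝ] X) (γ : Measure X) (f : X → ℝ) : Prop :=
  MemLp f 2 γ ∧ ∃ g : ℕ → X → ℝ, (∀ n, IsSmoothCylinder (g n)) ∧
    Tendsto (fun n => eLpNorm (g n - f) 2 γ) atTop (𝓝 0) ∧
    Tendsto (fun p : ℕ × ℕ => ∫ x, ⟪C (gradient (g p.1) x - gradient (g p.2) x),
      gradient (g p.1) x - gradient (g p.2) x⟫ ∂γ) atTop (𝓝 0)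

/-- The standing assumptions on the target `P ∝ exp(-U) N_C` and the candidate `Q`
(`γ` is `N_C`, and `⟨C DU, DU⟩ = ‖C^{1/2} DU‖²`). -/
structure GibbsAssumptions (C : X →L[ℝ] X) (γ : Measure X) (U : X → ℝ) (P Q : Measure X) :
    Prop where
  posTraceClass : IsPosTraceClass C
  gaussian : IsCenteredGaussian C γ
  differentiable : Differentiable ℝ U
  /-- `P` is the normalisation of `exp(-U) N_C`. -/
  gibbs : P = γ.tilted fun x => -U x
  sq_moment : Integrable (fun x => ‖x‖ ^ 2) Q
  drift_moment : Integrable (fun x => ‖C (gradient U x)‖) Q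
  sobolev : MemMalliavinSobolev C γ fun x => Real.exp (-U x / 2)
  gradient_sq : Integrable (fun x => ⟪C (gradient U x), gradient U x⟫) γ

/-- `Y₁, …, Yₙ` are independent random variables with law `Q`. -/
def IsIIDSample {Ω : Type*} [MeasurableSpace Ω] (μ : Measure Ω) {n : ℕ} (Y : Fin n → Ω → X)
    (Q : Measure X) : Prop :=
  iIndepFun Y μ ∧ ∀ i, AEMeasurable (Y i) μ ∧ μ.map (Y i) = Q

/-- The `U`-statistic `1/(n(n-1)) ∑_{i ≠ j} h(Yᵢ, Yⱼ)`. -/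
def uStatistic {Ω : Type*} (h : X → X → ℝ) {n : ℕ} (Y : Fin n → Ω → X) (ω : Ω) : ℝ :=
  (1 / ((n : ℝ) * ((n : ℝ) - 1))) * ∑ i, ∑ j, if i ≠ j then h (Y i ω) (Y j ω) else 0

end Measures

end

/-! Write `Φ x` for the canonical feature map, so that `⟪Φ x u, f⟫ = ⟪u, f x⟫`. At each point `x` a
Stein operator is a continuous linear functional on the Hilbert space of functions, hence is
represented by a vector `ξ x`. If `ξ` is Bochner integrable under `Q`, then `E_Q[A f] = ⟪f, ∫ ξ
dQ⟫`, the discrepancy is `‖∫ ξ dQ‖` (`ksd_eq_norm`), and its square is the double integral of `⟪ξ x,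
ξ x'⟫` (`integral_inner_prod`). For a scalar kernel this Gram kernel is `(A ⊗ A) k`.

Building `ξ` takes two ingredients. The first is regularity of the feature map: inner products of
its increments are second differences of the kernel, so a jointly continuous `D₁D₂k` forces `Φ` to
be differentiable in norm (`hasFDerivAt_of_gram`); repeating this for the derivative gives two
derivatives when `k ∈ C_b^{(2,2)}`. The second is the identity `Tr[C B] = ∫ ⟪B g, g⟫ dγ(g)`
(`IsCenteredGaussian.hasSum_trace`). It makes the trace basis-free and turns it into a bounded
linear map of the derivative. The trace part of `ξ` is therefore bounded and continuous, the drift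
part grows linearly in `x + C DU(x)`, and first moments of the drift suffice.

In the vectorised case `ξ x` is expanded along `eᵢ`. Since `K = k I`, the cross terms carry the
factor `⟪eᵢ, eⱼ⟫`, and only the diagonal, formed by the Gram kernels of the representers `ζᵢ` of
`Γᵢ`, survives. Exchanging this series with the expectation uses a weighted AM–GM bound adapted to
first moments (`hasSum_integral_inner_prod`). -/

section

set_option maxSynthPendingDepth 6

/-! ### Second differences and the symmetry of mixed partial derivatives. -/

section MixedDerivatives

variable {E F : Type*} [NormedAddCommGroup E] [NormedSpace ℝ E]
  [NormedAddCommGroup F] [NormedSpace ℝ F]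

/-- A jointly continuous mixed derivative `D₁D₂G` approximates second differences of `G`. -/
theorem exists_norm_second_difference_sub_le {G : E → E → F} {G₂ : E → E → E →L[ℝ] F}
    {G₁₂ : E → E → E →L[ℝ] E →L[ℝ] F}
    (h₂ : ∀ x y, HasFDerivAt (G x) (G₂ x y) y)
    (h₁₂ : ∀ x y, HasFDerivAt (fun z => G₂ z y) (G₁₂ x y) x)
    (hc : Continuous fun p : E × E => G₁₂ p.1 p.2) (x y : E) {ε : ℝ} (hε : 0 < ε) :
    ∃ δ > 0, ∀ h h' : E, ‖h‖ < δ → ‖h'‖ < δ →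
      ‖G (x + h) (y + h') - G (x + h) y - (G x (y + h') - G x y) - G₁₂ x y h h'‖
        ≤ ε * ‖h‖ * ‖h'‖ := by
  obtain ⟨δ, hδ, H⟩ := Metric.tendsto_nhds_nhds.1 (hc.tendsto (x, y)) ε hε
  have H' : ∀ a ∈ Metric.ball x δ, ∀ b ∈ Metric.ball y δ, ‖G₁₂ a b - G₁₂ x y‖ ≤ ε := by
    intro a ha b hb
    rw [← dist_eq_norm]
    refine (H (x := (a, b)) ?_).le
    simpa [Prod.dist_eq] using ⟨ha, hb⟩
  refine ⟨δ, hδ, fun h h' hh hh' => ?_⟩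
  have hxh : x + h ∈ Metric.ball x δ := by simpa using hh
  have hyh : y + h' ∈ Metric.ball y δ := by simpa using hh'
  -- The mean value inequality is used twice: here in the first variable for `G₂ · b`, then in the
  -- second variable for `G (x + h) - G x`.
  have step : ∀ b ∈ Metric.ball y δ, ‖G₂ (x + h) b - G₂ x b - G₁₂ x y h‖ ≤ ε * ‖h‖ := by
    intro b hb
    have := (convex_ball x δ).norm_image_sub_le_of_norm_hasFDerivWithin_le'
      (f := fun z => G₂ z b) (f' := fun z => G₁₂ z b) (φ := G₁₂ x y) (C := ε)
      (fun z _ => (h₁₂ z b).hasFDerivWithinAt) (fun z hz => H' z hz b hb)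
      (Metric.mem_ball_self hδ) hxh
    simpa using this
  have := (convex_ball y δ).norm_image_sub_le_of_norm_hasFDerivWithin_le'
      (f := fun b => G (x + h) b - G x b) (f' := fun b => G₂ (x + h) b - G₂ x b)
      (φ := G₁₂ x y h) (C := ε * ‖h‖)
      (fun z _ => ((h₂ (x + h) z).sub (h₂ x z)).hasFDerivWithinAt) step
      (Metric.mem_ball_self hδ) hyh
  simp only [add_sub_cancel_left] at this
  rwa [sub_sub_sub_comm] at this

/-- Schwarz's theorem: if `D₁D₂G` is jointly continuous, then `D₂D₁G` exists and agrees with it. -/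
theorem hasFDerivAt_partial_swap {G : E → E → F} {G₁ G₂ : E → E → E →L[ℝ] F}
    {G₁₂ : E → E → E →L[ℝ] E →L[ℝ] F}
    (h₁ : ∀ x y, HasFDerivAt (fun z => G z y) (G₁ x y) x)
    (h₂ : ∀ x y, HasFDerivAt (G x) (G₂ x y) y)
    (h₁₂ : ∀ x y, HasFDerivAt (fun z => G₂ z y) (G₁₂ x y) x)
    (hc : Continuous fun p : E × E => G₁₂ p.1 p.2) (x y : E) :
    HasFDerivAt (G₁ x) (G₁₂ x y).flip y := by
  rw [hasFDerivAt_iff_isLittleO_nhds_zero, Asymptotics.isLittleO_iff]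
  intro ε hε
  obtain ⟨δ, hδ, H⟩ := exists_norm_second_difference_sub_le h₂ h₁₂ hc x y hε
  filter_upwards [Metric.ball_mem_nhds (0 : E) hδ] with h' hh'
  have hh' : ‖h'‖ < δ := by simpa using hh'
  -- The remainder to be estimated is the derivative at `x` of this second difference, so a
  -- Lipschitz bound at `x` with constant `ε * ‖h'‖` bounds its norm.
  have hd : HasFDerivAt (fun z => G z (y + h') - G z y - (G₁₂ x y).flip h' (z - x))
      (G₁ x (y + h') - G₁ x y - (G₁₂ x y).flip h') x :=
    ((h₁ x (y + h')).sub (h₁ x y)).sub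
      (((G₁₂ x y).flip h').hasFDerivAt.comp x ((hasFDerivAt_id x).sub_const x))
  refine hd.le_of_lip' (by positivity) ?_
  filter_upwards [Metric.ball_mem_nhds x hδ] with z hz
  have hz : ‖z - x‖ < δ := by simpa [dist_eq_norm] using hz
  have := H (z - x) h' hz hh'
  simp only [add_sub_cancel, sub_self, map_zero, sub_zero, ContinuousLinearMap.flip_apply] at this ⊢
  calc _ = _ := by congr 1; abel
    _ ≤ _ := this
    _ = _ := by ring

end MixedDerivatives

/-! ### Differentiability of a Hilbert-space-valued map from its Gram kernel. -/

section FeatureMaps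

variable {H : Type*} [NormedAddCommGroup H] [InnerProductSpace ℝ H]

/-- Expanding the square, `‖q s - q t‖ ^ 2` tends to `c - 2 * c + c = 0`, so `q` is Cauchy along
`l`. -/
theorem exists_tendsto_of_tendsto_inner [CompleteSpace H] {α : Type*} {l : Filter α} [l.NeBot]
    {q : α → H} {c : ℝ} (hq : Tendsto (fun p : α × α => ⟪q p.1, q p.2⟫) (l ×ˢ l) (𝓝 c)) :
    ∃ a, Tendsto q l (𝓝 a) := by
  rw [← cauchy_map_iff_exists_tendsto, cauchy_map_iff]
  refine ⟨inferInstance, ?_⟩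
  rw [Metric.uniformity_eq_comap_nhds_zero, tendsto_comap_iff]
  have hdiag : Tendsto (fun t => ⟪q t, q t⟫) l (𝓝 c) := hq.comp (tendsto_id.prodMk tendsto_id)
  have h0 : Tendsto (fun p : α × α => ‖q p.1 - q p.2‖ ^ 2) (l ×ˢ l) (𝓝 (c - 2 * c + c)) := by
    refine (((hdiag.comp tendsto_fst).sub (hq.const_mul 2)).add
      (hdiag.comp tendsto_snd)).congr fun p => ?_
    simp [norm_sub_sq_real]
  have h1 := h0.sqrt
  rw [show c - 2 * c + c = 0 by ring, Real.sqrt_zero] at h1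
  refine h1.congr fun p => ?_
  simp [dist_eq_norm]

/-- The squared norms of `T (a + b) - T a - T b` and `T (c • a) - c • T a` depend only on the Gram
form, and bilinearity of `B` makes them vanish. -/
theorem exists_linearMap_of_inner_eq {M : Type*} [AddCommGroup M] [Module ℝ M] {T : M → H}
    (B : M →ₗ[ℝ] M →ₗ[ℝ] ℝ) (hT : ∀ a b, ⟪T a, T b⟫ = B a b) :
    (∀ a b, T (a + b) = T a + T b) ∧ ∀ (c : ℝ) a, T (c • a) = c • T a := by
  constructor
  · intro a b
    rw [← sub_eq_zero, ← inner_self_eq_zero (𝕜 := ℝ)]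
    simp only [inner_sub_left, inner_sub_right, inner_add_left, inner_add_right, hT, map_add,
      LinearMap.add_apply]
    ring
  · intro c a
    rw [← sub_eq_zero, ← inner_self_eq_zero (𝕜 := ℝ)]
    simp only [inner_sub_left, inner_sub_right, real_inner_smul_left, real_inner_smul_right, hT,
      map_smul, LinearMap.smul_apply, smul_eq_mul]
    ring

variable {E V : Type*} [NormedAddCommGroup E] [NormedSpace ℝ E] [NormedAddCommGroup V]
  [NormedSpace ℝ V]

theorem norm_le_sqrt_of_norm_sq_eq {H E V : Type*} [NormedAddCommGroup H] [NormedAddCommGroup E]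
    [NormedSpace ℝ E] [NormedAddCommGroup V] [NormedSpace ℝ V]
    (B : E →L[ℝ] E →L[ℝ] V →L[ℝ] V →L[ℝ] ℝ) {a : H} {h : E} {u : V}
    (ha : ‖a‖ ^ 2 = B h h u u) : ‖a‖ ≤ √‖B‖ * ‖h‖ * ‖u‖ := by
  refine abs_le_of_sq_le_sq' ?_ (by positivity) |>.2
  rw [ha, mul_pow, mul_pow, Real.sq_sqrt (norm_nonneg _)]
  calc B h h u u ≤ ‖B h h u u‖ := le_abs_self _
    _ ≤ ‖B h h‖ * ‖u‖ * ‖u‖ := ContinuousLinearMap.le_opNorm₂ _ _ _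
    _ ≤ (‖B‖ * ‖h‖ * ‖h‖) * ‖u‖ * ‖u‖ := by gcongr; exact ContinuousLinearMap.le_opNorm₂ _ _ _
    _ = _ := by ring

/-- The Gram matrix of difference quotients converges to `B`, so the quotients converge in `H`;
their limits are bilinear and bounded because `B` is. The estimate is uniform in `u` and `w`, which
upgrades directional derivatives to a Fréchet derivative in operator norm. -/
theorem hasFDerivAt_of_gram [CompleteSpace H] {Φ : E → V →L[ℝ] H} {x : E}
    (B : E →L[ℝ] E →L[ℝ] V →L[ℝ] V →L[ℝ] ℝ)
    (hB : ∀ ε > 0, ∃ δ > 0, ∀ h h' : E, ‖h‖ < δ → ‖h'‖ < δ → ∀ u w,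
      |⟪Φ (x + h) u - Φ x u, Φ (x + h') w - Φ x w⟫ - B h h' u w|
        ≤ ε * ‖h‖ * ‖h'‖ * ‖u‖ * ‖w‖) :
    ∃ T : E →L[ℝ] V →L[ℝ] H, HasFDerivAt Φ T x ∧
      ∀ h h' u w, ⟪T h u, T h' w⟫ = B h h' u w := by
  set q : E → V → ℝ → H := fun h u t => t⁻¹ • (Φ (x + t • h) u - Φ x u) with hq
  have small : ∀ (h : E) {δ : ℝ}, 0 < δ → ∀ᶠ t : ℝ in 𝓝[≠] 0, t ≠ 0 ∧ ‖t • h‖ < δ := by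
    intro h δ hδ
    have : Tendsto (fun t : ℝ => ‖t • h‖) (𝓝[≠] 0) (𝓝 0) := by
      refine Tendsto.mono_left ?_ nhdsWithin_le_nhds
      have : Continuous fun t : ℝ => ‖t • h‖ := by fun_prop
      simpa using this.tendsto 0
    exact (eventually_mem_nhdsWithin.mono fun t ht => ht).and (this.eventually_lt_const hδ)
  have hlim : ∀ h h' u w, Tendsto (fun p : ℝ × ℝ => ⟪q h u p.1, q h' w p.2⟫)
      (𝓝[≠] 0 ×ˢ 𝓝[≠] 0) (𝓝 (B h h' u w)) := by
    intro h h' u w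
    rw [Metric.tendsto_nhds]
    intro ε hε
    set K := ‖h‖ * ‖h'‖ * ‖u‖ * ‖w‖ with hK
    have hK0 : 0 ≤ K := by positivity
    -- `K + 1` instead of `K` covers the case where a direction vanishes.
    obtain ⟨δ, hδ, hD⟩ := hB (ε / (K + 1)) (by positivity)
    filter_upwards [(small h hδ).prod_mk (small h' hδ)] with p hp
    obtain ⟨⟨hs0, hs⟩, ht0, ht⟩ := hp
    have := hD _ _ hs ht u w
    rw [Real.dist_eq]
    have e : ⟪q h u p.1, q h' w p.2⟫ - B h h' u w = (p.1⁻¹ * p.2⁻¹) *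
        (⟪Φ (x + p.1 • h) u - Φ x u, Φ (x + p.2 • h') w - Φ x w⟫
          - B (p.1 • h) (p.2 • h') u w) := by
      simp only [hq, real_inner_smul_left, real_inner_smul_right, map_smul,
        smul_apply, smul_eq_mul]
      field_simp
    rw [e, abs_mul]
    calc _ ≤ |p.1⁻¹ * p.2⁻¹| * (ε / (K + 1) * ‖p.1 • h‖ * ‖p.2 • h'‖ * ‖u‖ * ‖w‖) := by gcongr
      _ = ε * (K / (K + 1)) := by
        have h1 : |p.1| ≠ 0 := abs_ne_zero.2 hs0
        have h2 : |p.2| ≠ 0 := abs_ne_zero.2 ht0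
        rw [abs_mul, abs_inv, abs_inv, norm_smul, norm_smul, Real.norm_eq_abs, Real.norm_eq_abs, hK]
        field_simp
      _ < ε := by
        have : K / (K + 1) < 1 := (div_lt_one (by positivity)).2 (by linarith)
        nlinarith
  choose T hT using fun h u => exists_tendsto_of_tendsto_inner (hlim h h u u)
  have hTT : ∀ h h' u w, ⟪T h u, T h' w⟫ = B h h' u w := fun h h' u w =>
    tendsto_nhds_unique ((hT h u).inner (hT h' w))
      ((hlim h h' u w).comp (tendsto_id.prodMk tendsto_id))
  have lin1 : ∀ u, (∀ a b, T (a + b) u = T a u + T b u) ∧ ∀ (c : ℝ) a, T (c • a) u = c • T a u :=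
    fun u => exists_linearMap_of_inner_eq (T := fun a => T a u)
      (LinearMap.mk₂ ℝ (fun h h' => B h h' u u) (by simp) (by simp) (by simp) (by simp))
      (fun a b => by simp [hTT])
  have lin2 : ∀ h, (∀ a b, T h (a + b) = T h a + T h b) ∧ ∀ (c : ℝ) a, T h (c • a) = c • T h a :=
    fun h => exists_linearMap_of_inner_eq (T := fun a => T h a)
      (LinearMap.mk₂ ℝ (fun u w => B h h u w) (by simp) (by simp) (by simp) (by simp))
      (fun a b => by simp [hTT])
  have bd : ∀ h u, ‖T h u‖ ≤ √‖B‖ * ‖h‖ * ‖u‖ := fun h u =>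
    norm_le_sqrt_of_norm_sq_eq B (by rw [← real_inner_self_eq_norm_sq, hTT])
  let T' : E →L[ℝ] V →L[ℝ] H := LinearMap.mkContinuous₂
    (LinearMap.mk₂ ℝ T (fun a b u => (lin1 u).1 a b) (fun c a u => (lin1 u).2 c a)
      (fun h a b => (lin2 h).1 a b) (fun c h a => (lin2 h).2 c a)) _ bd
  have hT' : ∀ h u, T' h u = T h u := fun h u => rfl
  refine ⟨T', ?_, fun h h' u w => hTT h h' u w⟩
  rw [hasFDerivAt_iff_isLittleO_nhds_zero, Asymptotics.isLittleO_iff]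
  intro ε hε
  -- In the expansion of `‖Φ (x + h) u - Φ x u - T h u‖ ^ 2` the last term is exactly `B h h u u`;
  -- the first has error one third and the doubled mixed term two thirds of `ε ^ 2 * ‖h‖ ^ 2 * ‖u‖ ^
  -- 2`. The mixed bound is the limit of the hypothesis with second increment `t • h`, `t → 0`.
  obtain ⟨δ, hδ, hD⟩ := hB (ε ^ 2 / 3) (by positivity)
  have mixed : ∀ h, ‖h‖ < δ → ∀ u, |⟪Φ (x + h) u - Φ x u, T h u⟫ - B h h u u|
      ≤ ε ^ 2 / 3 * ‖h‖ ^ 2 * ‖u‖ ^ 2 := by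
    intro h hh u
    have hl : Tendsto (fun t : ℝ => |⟪Φ (x + h) u - Φ x u, q h u t⟫ - B h h u u|) (𝓝[≠] 0)
        (𝓝 |⟪Φ (x + h) u - Φ x u, T h u⟫ - B h h u u|) :=
      ((tendsto_const_nhds.inner (hT h u)).sub_const _).abs
    refine le_of_tendsto hl ?_
    filter_upwards [small h hδ] with t ht
    have := hD h (t • h) hh ht.2 u u
    have e : ⟪Φ (x + h) u - Φ x u, q h u t⟫ - B h h u u = t⁻¹ *
        (⟪Φ (x + h) u - Φ x u, Φ (x + t • h) u - Φ x u⟫ - B h (t • h) u u) := by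
      simp only [hq, real_inner_smul_right, map_smul, smul_apply, smul_eq_mul]
      have := ht.1
      field_simp
    rw [e, abs_mul]
    calc _ ≤ |t⁻¹| * (ε ^ 2 / 3 * ‖h‖ * ‖t • h‖ * ‖u‖ * ‖u‖) := by gcongr
      _ = _ := by
        have h1 : |t| ≠ 0 := abs_ne_zero.2 ht.1
        rw [abs_inv, norm_smul, Real.norm_eq_abs]
        field_simp
  filter_upwards [Metric.ball_mem_nhds (0 : E) hδ] with h hh
  have hh : ‖h‖ < δ := by simpa using hh
  refine ContinuousLinearMap.opNorm_le_bound _ (by positivity) fun u => ?_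
  refine abs_le_of_sq_le_sq' ?_ (by positivity) |>.2
  have h1 := abs_le.1 (hD h h hh hh u u)
  have h2 := abs_le.1 (mixed h hh u)
  simp only [sub_apply, hT']
  rw [norm_sub_sq_real, ← real_inner_self_eq_norm_sq, ← real_inner_self_eq_norm_sq (T h u), hTT]
  nlinarith [h1.1, h1.2, h2.1, h2.2]

/-- A feature map `Φ` whose Gram kernel `G` has a jointly continuous mixed derivative `D₁D₂G`
is continuously differentiable. -/
theorem exists_hasFDerivAt_of_gram [CompleteSpace H] {Φ : E → V →L[ℝ] H}
    {G : E → E → V →L[ℝ] V →L[ℝ] ℝ} {G₂ : E → E → E →L[ℝ] V →L[ℝ] V →L[ℝ] ℝ}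
    {G₁₂ : E → E → E →L[ℝ] E →L[ℝ] V →L[ℝ] V →L[ℝ] ℝ}
    (hG : ∀ x y u w, G x y u w = ⟪Φ x u, Φ y w⟫)
    (h₂ : ∀ x y, HasFDerivAt (G x) (G₂ x y) y)
    (h₁₂ : ∀ x y, HasFDerivAt (fun z => G₂ z y) (G₁₂ x y) x)
    (hc : Continuous fun p : E × E => G₁₂ p.1 p.2) :
    ∃ T : E → E →L[ℝ] V →L[ℝ] H, (∀ x, HasFDerivAt Φ (T x) x) ∧ Continuous T ∧
      ∀ x y h h' u w, ⟪T x h u, T y h' w⟫ = G₁₂ x y h h' u w := by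
  have key : ∀ x, ∃ T : E →L[ℝ] V →L[ℝ] H, HasFDerivAt Φ T x := by
    intro x
    obtain ⟨T, hT, -⟩ := hasFDerivAt_of_gram (Φ := Φ) (x := x) (G₁₂ x x) (by
      intro ε hε
      obtain ⟨δ, hδ, hD⟩ := exists_norm_second_difference_sub_le h₂ h₁₂ hc x x hε
      refine ⟨δ, hδ, fun h h' hh hh' u w => ?_⟩
      have e : ⟪Φ (x + h) u - Φ x u, Φ (x + h') w - Φ x w⟫ - G₁₂ x x h h' u w =
          (G (x + h) (x + h') - G (x + h) x - (G x (x + h') - G x x) - G₁₂ x x h h') u w := by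
        simp only [sub_apply, hG, inner_sub_left, inner_sub_right]
        ring
      rw [e, ← Real.norm_eq_abs]
      refine (ContinuousLinearMap.le_opNorm₂ _ _ _).trans ?_
      gcongr
      exact hD h h' hh hh')
    exact ⟨T, hT⟩
  choose T hT using key
  have apply_deriv : ∀ x u, HasFDerivAt (fun z => Φ z u) ((T x).flip u) x := fun x u => by
    simpa using (hT x).clm_apply (hasFDerivAt_const u x)
  have g2 : ∀ x y h' u w, G₂ x y h' u w = ⟪Φ x u, T y h' w⟫ := by
    intro x y h' u w
    have e1 := ((h₂ x y).clm_apply (hasFDerivAt_const u y)).clm_apply (hasFDerivAt_const w y)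
    have e2 := (hasFDerivAt_const (Φ x u) y).inner ℝ (apply_deriv y w)
    simp only [hG] at e1
    simpa using congrArg (fun L => L h') (e1.unique e2)
  have g12 : ∀ x y h h' u w, ⟪T x h u, T y h' w⟫ = G₁₂ x y h h' u w := by
    intro x y h h' u w
    have e1 := (((h₁₂ x y).clm_apply (hasFDerivAt_const h' x)).clm_apply
      (hasFDerivAt_const u x)).clm_apply (hasFDerivAt_const w x)
    have e2 := (apply_deriv x u).inner ℝ (hasFDerivAt_const (T y h' w) x)
    simp only [g2] at e1
    simpa using (congrArg (fun L => L h) (e1.unique e2)).symm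
  refine ⟨T, hT, ?_, g12⟩
  rw [continuous_iff_continuousAt]
  intro x
  -- The form under the root is the Gram form of `T z - T x`, so its norm controls `‖T z - T x‖ ^
  -- 2`.
  have hlim : Tendsto (fun z => √‖G₁₂ z z - G₁₂ z x - G₁₂ x z + G₁₂ x x‖) (𝓝 x) (𝓝 0) := by
    have : Continuous fun z => √‖G₁₂ z z - G₁₂ z x - G₁₂ x z + G₁₂ x x‖ :=
      ((((hc.comp (continuous_id.prodMk continuous_id)).sub
        (hc.comp (continuous_id.prodMk continuous_const))).sub
        (hc.comp (continuous_const.prodMk continuous_id))).add continuous_const).norm.sqrt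
    simpa using this.tendsto x
  rw [ContinuousAt, tendsto_iff_norm_sub_tendsto_zero]
  refine squeeze_zero (fun _ => norm_nonneg _) (fun z => ?_) hlim
  refine ContinuousLinearMap.opNorm_le_bound₂ _ (Real.sqrt_nonneg _) fun h u => ?_
  set D := G₁₂ z z - G₁₂ z x - G₁₂ x z + G₁₂ x x
  refine norm_le_sqrt_of_norm_sq_eq D ?_
  rw [← real_inner_self_eq_norm_sq]
  simp only [D, sub_apply, add_apply, inner_sub_left, inner_sub_right, g12]
  ring

end FeatureMaps

/-! ### Iterated derivatives of order one and two as nested Fréchet derivatives. -/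

section IteratedDerivatives

variable {E : Type*} [NormedAddCommGroup E] [NormedSpace ℝ E]

/-- The isometry `J` does not depend on `f`, so continuity and bounds can be moved between the
multilinear and nested forms. -/
theorem exists_iteratedFDeriv_one_eq (F : Type*) [NormedAddCommGroup F] [NormedSpace ℝ F] :
    ∃ J : (E →L[ℝ] F) ≃ₗᵢ[ℝ] ContinuousMultilinearMap ℝ (fun _ : Fin 1 => E) F,
      ∀ f : E → F, iteratedFDeriv ℝ 1 f = J ∘ fderiv ℝ f := by
  refine ⟨(continuousMultilinearCurryFin0 ℝ E (E →L[ℝ] F)).symm.trans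
    (continuousMultilinearCurryRightEquiv' ℝ 0 E F).symm, fun f => ?_⟩
  funext x
  refine (iteratedFDeriv_succ_eq_comp_right (n := 0)).trans ?_
  rw [iteratedFDeriv_zero_eq_comp]
  rfl

theorem exists_iteratedFDeriv_two_eq (F : Type*) [NormedAddCommGroup F] [NormedSpace ℝ F] :
    ∃ J : (E →L[ℝ] E →L[ℝ] F) ≃ₗᵢ[ℝ] ContinuousMultilinearMap ℝ (fun _ : Fin 2 => E) F,
      ∀ f : E → F, iteratedFDeriv ℝ 2 f = J ∘ fderiv ℝ (fderiv ℝ f) := by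
  obtain ⟨J, hJ⟩ := exists_iteratedFDeriv_one_eq (E := E) (E →L[ℝ] F)
  refine ⟨J.trans (continuousMultilinearCurryRightEquiv' ℝ 1 E F).symm, fun f => ?_⟩
  funext x
  refine (iteratedFDeriv_succ_eq_comp_right (n := 1)).trans ?_
  rw [hJ]
  rfl

end IteratedDerivatives

/-! ### Bounded mixed derivatives supplied by `C_b^{(α,α)}` kernels. -/

section BoundedDerivatives

variable {X : Type*} [NormedAddCommGroup X] [InnerProductSpace ℝ X]

theorem IsCb.of_le {α β : ℕ} {k : X → X → ℝ} (h : IsCb α k) (hβ : β ≤ α) : IsCb β k where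
  contDiff_snd x := (h.contDiff_snd x).of_le (by exact_mod_cast hβ)
  contDiff_fst j hj y := (h.contDiff_fst j (hj.trans hβ) y).of_le (by exact_mod_cast hβ)
  continuous i hi j hj := h.continuous i (hi.trans hβ) j (hj.trans hβ)
  bounded i hi j hj := h.bounded i (hi.trans hβ) j (hj.trans hβ)

/-- The conditions in `IsCb` may be checked on any isometric copy `D` of the `j`-th derivative
in the second argument. -/
theorem IsCb.of_isometry {α : ℕ} {k : X → X → ℝ} (hk : IsCb α k) {j : ℕ} (hj : j ≤ α)
    {F : Type*} [NormedAddCommGroup F] [NormedSpace ℝ F] (D : X → X → F)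
    (J : F ≃ₗᵢ[ℝ] ContinuousMultilinearMap ℝ (fun _ : Fin j => X) ℝ)
    (hJ : ∀ x y, iteratedFDeriv ℝ j (k x) y = J (D x y)) :
    (∀ y, ContDiff ℝ α fun x => D x y) ∧
    (∀ i ≤ α, Continuous fun p : X × X => iteratedFDeriv ℝ i (fun x => D x p.2) p.1) ∧
    ∀ i ≤ α, ∃ M : ℝ, ∀ x y, ‖iteratedFDeriv ℝ i (fun x => D x y) x‖ ≤ M := by
  have hD : ∀ x y, D x y = J.symm (iteratedFDeriv ℝ j (k x) y) := fun x y => by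
    rw [hJ, J.symm_apply_apply]
  have hfun : ∀ y, (fun x => D x y) = J.symm ∘ fun x => iteratedFDeriv ℝ j (k x) y := fun y =>
    funext fun x => hD x y
  refine ⟨fun y => ?_, fun i hi => ?_, fun i hi => ?_⟩
  · rw [hfun]
    exact J.symm.contDiff.comp (hk.contDiff_fst j hj y)
  · have h := ((ContinuousLinearMap.compContinuousMultilinearMapL ℝ (fun _ : Fin i => X) _ _
      (J.symm.toContinuousLinearEquiv : _ →L[ℝ] F)).continuous).comp (hk.continuous i hi j hj)
    refine h.congr fun p => ?_
    rw [hfun]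
    exact (J.symm.toContinuousLinearEquiv.iteratedFDeriv_comp_left
      (f := fun x => iteratedFDeriv ℝ j (k x) p.2) (x := p.1) (i := i)).symm
  · obtain ⟨M, hM⟩ := hk.bounded i hi j hj
    refine ⟨M, fun x y => ?_⟩
    rw [hfun, J.symm.norm_iteratedFDeriv_comp_left]
    exact hM x y

/-- `D` is a bounded jointly continuous mixed derivative `D₁D₂G`. -/
structure HasBoundedMixedDeriv {F : Type*} [NormedAddCommGroup F] [NormedSpace ℝ F]
    (G : X → X → F) (G₂ : X → X → X →L[ℝ] F) (G₁₂ : X → X → X →L[ℝ] X →L[ℝ] F) : Prop where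
  snd : ∀ x y, HasFDerivAt (G x) (G₂ x y) y
  fst : ∀ x y, HasFDerivAt (fun z => G₂ z y) (G₁₂ x y) x
  continuous : Continuous fun p : X × X => G₁₂ p.1 p.2
  bounded : ∃ M : ℝ, ∀ x y, ‖G₁₂ x y‖ ≤ M

theorem IsCb.exists_bound {α : ℕ} {k : X → X → ℝ} (hk : IsCb α k) : ∃ M, ∀ x y, |k x y| ≤ M := by
  obtain ⟨M, hM⟩ := (hk.of_isometry (Nat.zero_le α) k
    (continuousMultilinearCurryFin0 ℝ X ℝ).symm (fun x y => by
      rw [iteratedFDeriv_zero_eq_comp]; rfl)).2.2 0 (Nat.zero_le α)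
  refine ⟨M, fun x y => ?_⟩
  simpa using hM x y

theorem IsCb.hasBoundedMixedDeriv {k : X → X → ℝ} (hk : IsCb 1 k) :
    HasBoundedMixedDeriv k (fun x y => fderiv ℝ (k x) y)
      fun x y => fderiv ℝ (fun z => fderiv ℝ (k z) y) x := by
  obtain ⟨J, hJ⟩ := exists_iteratedFDeriv_one_eq (E := X) ℝ
  obtain ⟨I, hI⟩ := exists_iteratedFDeriv_one_eq (E := X) (X →L[ℝ] ℝ)
  obtain ⟨h1, h2, h3⟩ := hk.of_isometry le_rfl (fun x y => fderiv ℝ (k x) y) J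
    (fun x y => by rw [hJ]; rfl)
  refine ⟨fun x y => ((hk.contDiff_snd x).differentiable (by simp) y).hasFDerivAt,
    fun x y => ((h1 y).differentiable (by simp) x).hasFDerivAt, ?_, ?_⟩
  · refine (I.symm.continuous.comp (h2 1 le_rfl)).congr fun p => ?_
    simp [hI]
  · obtain ⟨M, hM⟩ := h3 1 le_rfl
    refine ⟨M, fun x y => ?_⟩
    simpa [hI] using hM x y

/-- The derivative of the feature map has Gram kernel `D₁D₂k`, so its own differentiability needs
`D₁D₂D₁D₂k`, whereas `IsCb` provides `D₁²D₂²k`. Schwarz's theorem identifies `D₂D₁D₂k` with the flip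
`S` of `D₁D₂²k`, and one more derivative in the first argument then suffices. -/
theorem IsCb.exists_hasBoundedMixedDeriv {k : X → X → ℝ} (hk : IsCb 2 k) :
    ∃ (G₂ : X → X → X →L[ℝ] X →L[ℝ] X →L[ℝ] ℝ)
      (G₁₂ : X → X → X →L[ℝ] X →L[ℝ] X →L[ℝ] X →L[ℝ] ℝ),
      HasBoundedMixedDeriv (fun x y => fderiv ℝ (fun z => fderiv ℝ (k z) y) x) G₂ G₁₂ := by
  have hk₁ := (hk.of_le one_le_two).hasBoundedMixedDeriv
  obtain ⟨J, hJ⟩ := exists_iteratedFDeriv_two_eq (E := X) ℝ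
  obtain ⟨I₁, hI₁⟩ := exists_iteratedFDeriv_one_eq (E := X) (X →L[ℝ] X →L[ℝ] ℝ)
  obtain ⟨I₂, hI₂⟩ := exists_iteratedFDeriv_two_eq (E := X) (X →L[ℝ] X →L[ℝ] ℝ)
  set D : X → X → X →L[ℝ] X →L[ℝ] ℝ := fun x y => fderiv ℝ (fderiv ℝ (k x)) y with hD
  obtain ⟨h1, h2, h3⟩ := hk.of_isometry le_rfl D J (fun x y => by rw [hJ]; rfl)
  have hc : Continuous fun p : X × X => fderiv ℝ (fun z => D z p.2) p.1 := by
    refine (I₁.symm.continuous.comp (h2 1 one_le_two)).congr fun p => ?_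
    simp [hI₁]
  have hd : ∀ y, ContDiff ℝ 1 (fderiv ℝ fun z => D z y) := fun y =>
    (h1 y).fderiv_right (m := 1) (by norm_num)
  let S : (X →L[ℝ] X →L[ℝ] X →L[ℝ] ℝ) →L[ℝ] (X →L[ℝ] X →L[ℝ] X →L[ℝ] ℝ) :=
    (ContinuousLinearMap.flipₗᵢ ℝ X X (X →L[ℝ] ℝ)).toContinuousLinearEquiv
  have hS : ∀ T, ‖S T‖ = ‖T‖ := fun T => (ContinuousLinearMap.flipₗᵢ ℝ X X (X →L[ℝ] ℝ)).norm_map T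
  refine ⟨fun x y => S (fderiv ℝ (fun z => D z y) x),
    fun x y => S ∘L fderiv ℝ (fderiv ℝ fun z => D z y) x, ?_, ?_, ?_, ?_⟩
  · intro x y
    refine hasFDerivAt_partial_swap (G := fun x y => fderiv ℝ (k x) y) hk₁.fst (G₂ := D)
      (G₁₂ := fun x y => fderiv ℝ (fun z => D z y) x) ?_ ?_ hc x y
    · exact fun x y => (((hk.contDiff_snd x).fderiv_right (m := 1) (by norm_num)).differentiable
        (by simp) y).hasFDerivAt
    · exact fun x y => ((h1 y).differentiable (by simp) x).hasFDerivAt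
  · intro x y
    exact S.hasFDerivAt.comp x ((hd y).differentiable (by simp) x).hasFDerivAt
  · refine continuous_const.clm_comp ((I₂.symm.continuous.comp (h2 2 le_rfl)).congr fun p => ?_)
    simp [hI₂]
  · obtain ⟨M, hM⟩ := h3 2 le_rfl
    refine ⟨M, fun x y => ?_⟩
    refine ContinuousLinearMap.opNorm_le_bound _ ((norm_nonneg _).trans (hM x y)) fun h => ?_
    rw [ContinuousLinearMap.comp_apply, hS]
    refine (ContinuousLinearMap.le_opNorm _ _).trans ?_
    gcongr
    simpa [hI₂] using hM x y

end BoundedDerivatives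

/-! ### Functions in the space as images of the feature map. -/

section AdjointEvaluation

variable {V H : Type*} [NormedAddCommGroup V] [InnerProductSpace ℝ V] [CompleteSpace V]
  [NormedAddCommGroup H] [InnerProductSpace ℝ H] [CompleteSpace H]

/-- The bounded linear map `T ↦ T† f`. -/
noncomputable def adjointEval (f : H) : (V →L[ℝ] H) →L[ℝ] V :=
  LinearMap.mkContinuous
    { toFun := fun T => ContinuousLinearMap.adjoint T f
      map_add' := by simp
      map_smul' := by simp } ‖f‖ fun T => by
    refine ((ContinuousLinearMap.adjoint T).le_opNorm f).trans ?_
    rw [LinearIsometryEquiv.norm_map, mul_comm]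

theorem inner_adjointEval (f : H) (T : V →L[ℝ] H) (v : V) : ⟪adjointEval f T, v⟫ = ⟪f, T v⟫ :=
  ContinuousLinearMap.adjoint_inner_left T v f

end AdjointEvaluation

/-! ### The trace as a Gaussian second moment. -/

section GaussianTrace

variable {X : Type*} [NormedAddCommGroup X] [InnerProductSpace ℝ X]

theorem HilbertBasis.countable [TopologicalSpace.SeparableSpace X] {ι : Type*}
    (b : HilbertBasis ι ℝ X) : Countable ι := by
  refine Pairwise.countable_of_isOpen_disjoint (s := fun i => Metric.ball (b i) (1 / 2)) ?_
    (fun i => Metric.isOpen_ball) (fun i => ⟨b i, by simp⟩)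
  intro i j hij
  refine Metric.ball_disjoint_ball ?_
  have h : ‖b i - b j‖ ^ 2 = 2 := by
    rw [norm_sub_sq_real, b.orthonormal.2 hij, b.orthonormal.1, b.orthonormal.1]
    norm_num
  rw [dist_eq_norm]
  nlinarith [norm_nonneg (b i - b j)]

theorem HilbertBasis.hasSum_inner_sq {ι : Type*} (b : HilbertBasis ι ℝ X) (x : X) :
    HasSum (fun i => ⟪b i, x⟫ ^ 2) (‖x‖ ^ 2) := by
  rw [← real_inner_self_eq_norm_sq]
  refine (b.hasSum_inner_mul_inner x x).congr_fun fun i => ?_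
  rw [sq, real_inner_comm]

variable [MeasurableSpace X] [BorelSpace X]
  {C : X →L[ℝ] X} {γ : Measure X}

theorem measurable_inner_left (u : X) : Measurable fun x : X => ⟪u, x⟫ :=
  (continuous_const.inner continuous_id).measurable

theorem IsCenteredGaussian.memLp_inner (hγ : IsCenteredGaussian C γ) (u : X) :
    MemLp (fun x => ⟪u, x⟫) 2 γ := by
  have h : MemLp id 2 (γ.map fun x => ⟪u, x⟫) := by
    rw [hγ u]
    exact memLp_id_gaussianReal 2
  exact (memLp_map_measure_iff h.1 (measurable_inner_left u).aemeasurable).1 h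

theorem IsCenteredGaussian.integrable_inner_mul_inner (hγ : IsCenteredGaussian C γ) (u v : X) :
    Integrable (fun x => ⟪u, x⟫ * ⟪v, x⟫) γ :=
  (hγ.memLp_inner u).integrable_mul (hγ.memLp_inner v)

theorem IsCenteredGaussian.integral_inner_sq (hγ : IsCenteredGaussian C γ) (hC : C.IsPositive)
    (u : X) : ∫ x, ⟪u, x⟫ * ⟪u, x⟫ ∂γ = ⟪C u, u⟫ := by
  have h : ∫ y, y * y ∂(γ.map fun x => ⟪u, x⟫) = ⟪C u, u⟫ := by
    rw [hγ u]
    have := variance_eq_sub (memLp_id_gaussianReal (μ := 0) (v := ⟪C u, u⟫.toNNReal) 2)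
    rw [variance_id_gaussianReal] at this
    simp only [id, integral_id_gaussianReal, Pi.pow_apply] at this
    rw [Real.coe_toNNReal _ (hC.inner_nonneg_left u)] at this
    simp only [← sq]
    linarith
  rw [← h, integral_map (measurable_inner_left u).aemeasurable (by fun_prop)]

theorem IsCenteredGaussian.integral_inner_mul_inner (hγ : IsCenteredGaussian C γ)
    (hC : C.IsPositive) (u v : X) : ∫ x, ⟪u, x⟫ * ⟪v, x⟫ ∂γ = ⟪C u, v⟫ := by
  have h := hγ.integral_inner_sq hC (u + v)
  have e : ∀ x, ⟪u + v, x⟫ * ⟪u + v, x⟫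
      = ⟪u, x⟫ * ⟪u, x⟫ + ⟪v, x⟫ * ⟪v, x⟫ + 2 * (⟪u, x⟫ * ⟪v, x⟫) := fun x => by
    rw [inner_add_left]; ring
  have i := hγ.integrable_inner_mul_inner
  have s : ⟪C v, u⟫ = ⟪C u, v⟫ := by
    rw [real_inner_comm]; exact (hC.isSymmetric u v).symm
  simp only [e] at h
  rw [integral_add (f := fun x => ⟪u, x⟫ * ⟪u, x⟫ + ⟪v, x⟫ * ⟪v, x⟫) ((i u u).add (i v v))
    ((i u v).const_mul 2), integral_add (i u u) (i v v), integral_const_mul, hγ.integral_inner_sq hC, hγ.integral_inner_sq hC] at h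
  simp only [map_add, inner_add_left, inner_add_right, s] at h
  linarith

variable [TopologicalSpace.SeparableSpace X]

theorem IsCenteredGaussian.integrable_norm_sq [CompleteSpace X]
    (hγ : IsCenteredGaussian C γ) (hC : IsPosTraceClass C) : Integrable (fun x => ‖x‖ ^ 2) γ := by
  obtain ⟨w, b, -⟩ := exists_hilbertBasis ℝ X
  have := b.countable
  refine ⟨by fun_prop, ?_⟩
  rw [hasFiniteIntegral_iff_ofReal (ae_of_all _ fun x => by positivity)]
  have e : ∀ x : X, ENNReal.ofReal (‖x‖ ^ 2) = ∑' i, ENNReal.ofReal (⟪b i, x⟫ ^ 2) := fun x => by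
    rw [← (b.hasSum_inner_sq x).tsum_eq,
      ENNReal.ofReal_tsum_of_nonneg (fun i => by positivity) (b.hasSum_inner_sq x).summable]
  simp only [e]
  rw [lintegral_tsum fun i => by fun_prop]
  have e' : ∀ i, ∫⁻ x, ENNReal.ofReal (⟪b i, x⟫ ^ 2) ∂γ = ENNReal.ofReal ⟪C (b i), b i⟫ := by
    intro i
    simp only [sq]
    rw [← ofReal_integral_eq_lintegral_ofReal (hγ.integrable_inner_mul_inner _ _)
      (ae_of_all _ fun x => mul_self_nonneg _), hγ.integral_inner_sq hC.isPositive]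
  simp only [e']
  rw [← ENNReal.ofReal_tsum_of_nonneg (fun i => hC.isPositive.inner_nonneg_left _)
    (hC.summable w b)]
  exact ENNReal.ofReal_lt_top

/-- Parseval expands `⟪B x, x⟫`, each term integrates to a covariance, and AM–GM with Parseval gives
a dominating function of order `‖x‖ ^ 2`. The sum does not depend on the basis, so the choice in
`opTrace` is harmless. -/
theorem IsCenteredGaussian.hasSum_trace [CompleteSpace X] (hγ : IsCenteredGaussian C γ) (hC : IsPosTraceClass C)
    {ι : Type*} (b : HilbertBasis ι ℝ X) (B : X →L[ℝ] X) :
    HasSum (fun i => ⟪C (B (b i)), b i⟫) (∫ x, ⟪B x, x⟫ ∂γ) := by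
  have := b.countable
  have hsum : ∀ x, HasSum (fun i => ⟪B (b i), x⟫ * ⟪b i, x⟫) ⟪B x, x⟫ := fun x => by
    have h := b.hasSum_inner_mul_inner (ContinuousLinearMap.adjoint B x) x
    simp only [ContinuousLinearMap.adjoint_inner_left] at h
    rw [real_inner_comm]
    exact h.congr_fun fun i => by rw [real_inner_comm]
  have hbd : ∀ x, HasSum (fun i => (⟪B (b i), x⟫ ^ 2 + ⟪b i, x⟫ ^ 2) / 2)
      ((‖ContinuousLinearMap.adjoint B x‖ ^ 2 + ‖x‖ ^ 2) / 2) := fun x => by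
    refine HasSum.div_const (HasSum.add ?_ (b.hasSum_inner_sq x)) 2
    refine (b.hasSum_inner_sq (ContinuousLinearMap.adjoint B x)).congr_fun fun i => ?_
    rw [ContinuousLinearMap.adjoint_inner_right]
  have h := hasSum_integral_of_dominated_convergence (μ := γ)
    (F := fun i x => ⟪B (b i), x⟫ * ⟪b i, x⟫) (f := fun x => ⟪B x, x⟫)
    (fun i x => (⟪B (b i), x⟫ ^ 2 + ⟪b i, x⟫ ^ 2) / 2)
    (fun i => (hγ.integrable_inner_mul_inner _ _).1)
    (fun i => ae_of_all _ fun x => by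
      rw [Real.norm_eq_abs, abs_mul, ← sq_abs, ← sq_abs ⟪b i, x⟫]
      nlinarith [sq_nonneg (|⟪B (b i), x⟫| - |⟪b i, x⟫|)])
    (ae_of_all _ fun x => (hbd x).summable) ?_ (ae_of_all _ hsum)
  · exact h.congr_fun fun i => (hγ.integral_inner_mul_inner hC.isPositive _ _).symm
  · simp only [fun x => (hbd x).tsum_eq]
    refine Integrable.div_const (Integrable.add ?_ (hγ.integrable_norm_sq hC)) 2
    refine ((hγ.integrable_norm_sq hC).const_mul (‖ContinuousLinearMap.adjoint B‖ ^ 2)).mono'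
      (by fun_prop) (ae_of_all _ fun x => ?_)
    rw [Real.norm_of_nonneg (by positivity), ← mul_pow]
    gcongr
    exact ContinuousLinearMap.le_opNorm _ _

theorem IsCenteredGaussian.opTrace_comp [CompleteSpace X] (hγ : IsCenteredGaussian C γ) (hC : IsPosTraceClass C)
    (B : X →L[ℝ] X) : opTrace (C ∘L B) = ∫ x, ⟪B x, x⟫ ∂γ :=
  (hγ.hasSum_trace hC _ B).tsum_eq

/-- Cyclicity of the trace: the adjoint of `B` gives the same quadratic form. In this order `C` acts
on the basis vector, as in `Γᵢ`. -/
theorem IsCenteredGaussian.hasSum_trace_comp [CompleteSpace X] (hγ : IsCenteredGaussian C γ) (hC : IsPosTraceClass C)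
    {ι : Type*} (b : HilbertBasis ι ℝ X) (B : X →L[ℝ] X) :
    HasSum (fun i => ⟪B (C (b i)), b i⟫) (∫ x, ⟪B x, x⟫ ∂γ) := by
  have h := hγ.hasSum_trace hC b (ContinuousLinearMap.adjoint B)
  simp only [ContinuousLinearMap.adjoint_inner_left] at h
  simp only [fun x => real_inner_comm (B x) x] at h
  refine h.congr_fun fun i => ?_
  rw [← ContinuousLinearMap.adjoint_inner_right]
  exact (hC.isPositive.isSymmetric _ _).trans (real_inner_comm _ _)

variable {H : Type*} [NormedAddCommGroup H] [InnerProductSpace ℝ H]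

theorem integrable_apply_self (hγ : Integrable (fun x => ‖x‖ ^ 2) γ) (T : X →L[ℝ] X →L[ℝ] H) :
    Integrable (fun x => T x x) γ := by
  have : SecondCountableTopology X := UniformSpace.secondCountable_of_separable X
  have hT : Continuous fun x => T x x := by fun_prop
  refine (hγ.const_mul ‖T‖).mono' hT.aestronglyMeasurable (ae_of_all _ fun x => ?_)
  rw [sq, ← mul_assoc]
  exact T.le_opNorm₂ x x

/-- The second moment map `T ↦ ∫ T(x, x) dγ(x)` is a bounded linear map. -/
theorem exists_integral_apply_self_clm (hγ : Integrable (fun x => ‖x‖ ^ 2) γ) :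
    ∃ τ : (X →L[ℝ] X →L[ℝ] H) →L[ℝ] H, ∀ T, τ T = ∫ x, T x x ∂γ := by
  refine ⟨LinearMap.mkContinuous
    { toFun := fun T => ∫ x, T x x ∂γ
      map_add' := fun S T => by
        simp only [add_apply]
        exact integral_add (integrable_apply_self hγ S) (integrable_apply_self hγ T)
      map_smul' := fun c T => by
        simp only [smul_apply]
        exact integral_smul c _ } (∫ x, ‖x‖ ^ 2 ∂γ) fun T => ?_, fun T => rfl⟩
  refine (norm_integral_le_of_norm_le (hγ.const_mul ‖T‖) (ae_of_all _ fun x => ?_)).trans ?_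
  · rw [sq, ← mul_assoc]
    exact T.le_opNorm₂ x x
  · rw [integral_const_mul, mul_comm]

end GaussianTrace

/-! ### The discrepancy as the norm of a mean embedding. -/

section Discrepancy

variable {X : Type*} [MeasurableSpace X]
  {V : Type*} [NormedAddCommGroup V] [InnerProductSpace ℝ V]
  {H : Type*} [NormedAddCommGroup H] [InnerProductSpace ℝ H] [RKHS ℝ H X V]
  {A : (X → V) → X → ℝ} {Q : Measure X} {ξ : X → H}

theorem integrable_of_representer (hξ : Integrable ξ Q) (hA : ∀ (f : H) x, A f x = ⟪ξ x, f⟫)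
    (f : H) : Integrable (A f) Q := by
  rw [show A f = fun x => ⟪ξ x, f⟫ from funext (hA f)]
  exact hξ.inner_const f

/-- With `η = ∫ ξ dQ`, Cauchy–Schwarz bounds `|⟪f, η⟫|` on the unit ball, and the bound is attained
at `η / ‖η‖` unless `η = 0`. -/
theorem ksd_eq_norm [CompleteSpace H] (hξ : Integrable ξ Q) (hA : ∀ (f : H) x, A f x = ⟪ξ x, f⟫) :
    ksd H A Q = ENNReal.ofReal ‖∫ x, ξ x ∂Q‖ := by
  set η := ∫ x, ξ x ∂Q with hη
  have h : ∀ f : H, ∫ x, A f x ∂Q = ⟪f, η⟫ := fun f => by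
    simp only [hA, hη, ← integral_inner hξ f, fun x => real_inner_comm f (ξ x)]
  simp only [ksd, h]
  refine le_antisymm (iSup₂_le fun f hf => ENNReal.ofReal_le_ofReal ?_) ?_
  · refine (abs_real_inner_le_norm f η).trans ?_
    exact mul_le_of_le_one_left (norm_nonneg _) hf
  · rcases eq_or_ne η 0 with h0 | h0
    · simp [h0]
    · have hn : ‖η‖ ≠ 0 := norm_ne_zero_iff.2 h0
      refine le_iSup₂_of_le (‖η‖⁻¹ • η) (by rw [norm_smul, norm_inv, norm_norm, inv_mul_cancel₀ hn])
        (ENNReal.ofReal_le_ofReal (le_of_eq ?_))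
      rw [real_inner_smul_left, real_inner_self_eq_norm_sq, sq, inv_mul_cancel_left₀ hn, abs_norm]

end Discrepancy

/-! ### Squared norm of a mean as a double integral. -/

section PairExpectation

variable {X : Type*} [MeasurableSpace X] {H : Type*} [NormedAddCommGroup H]
  [InnerProductSpace ℝ H] {Q : Measure X} {ξ : X → H}

theorem integrable_inner_prod (hξ : Integrable ξ Q) :
    Integrable (fun p : X × X => ⟪ξ p.1, ξ p.2⟫) (Q.prod Q) :=
  hξ.op_fst_snd (op := fun a b => ⟪a, b⟫) continuous_inner
    ⟨1, fun a b => by rw [one_mul]; exact norm_inner_le_norm a b⟩ hξ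

theorem integral_inner_prod [SFinite Q] [CompleteSpace H] (hξ : Integrable ξ Q) :
    ∫ p : X × X, ⟪ξ p.1, ξ p.2⟫ ∂(Q.prod Q) = ‖∫ x, ξ x ∂Q‖ ^ 2 := by
  rw [integral_prod _ (integrable_inner_prod hξ), ← real_inner_self_eq_norm_sq, ← integral_inner hξ]
  refine integral_congr_ae (ae_of_all _ fun x => ?_)
  simp only [integral_inner hξ]
  exact real_inner_comm _ _

end PairExpectation

/-! ### Unbiasedness of the `U`-statistic. -/

section UStatistic

variable {X Ω : Type*} [MeasurableSpace X] [MeasurableSpace Ω]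

/-- The `U`-statistic of an i.i.d. sample is an unbiased estimator of the mean of its kernel. -/
theorem IsIIDSample.integral_uStatistic {Q : Measure X} [IsProbabilityMeasure Q] {h : X → X → ℝ}
    (hh : Integrable (fun p : X × X => h p.1 p.2) (Q.prod Q)) {μ : Measure Ω}
    [IsProbabilityMeasure μ] {n : ℕ} {Y : Fin n → Ω → X} (hn : 2 ≤ n) (hY : IsIIDSample μ Y Q) :
    Integrable (uStatistic h Y) μ ∧
      ∫ ω, uStatistic h Y ω ∂μ = ∫ p : X × X, h p.1 p.2 ∂(Q.prod Q) := by
  set m := ∫ p : X × X, h p.1 p.2 ∂(Q.prod Q) with hm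
  have key : ∀ i j, i ≠ j → Integrable (fun ω => h (Y i ω) (Y j ω)) μ ∧
      ∫ ω, h (Y i ω) (Y j ω) ∂μ = m := by
    intro i j hij
    have hmap : μ.map (fun ω => (Y i ω, Y j ω)) = Q.prod Q := by
      rw [(indepFun_iff_map_prod_eq_prod_map_map (hY.2 i).1 (hY.2 j).1).1 (hY.1.indepFun hij),
        (hY.2 i).2, (hY.2 j).2]
    have hae : AEMeasurable (fun ω => (Y i ω, Y j ω)) μ := (hY.2 i).1.prodMk (hY.2 j).1
    rw [← hmap] at hh
    refine ⟨(integrable_map_measure hh.1 hae).1 hh, ?_⟩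
    rw [hm, ← hmap, integral_map hae hh.1]
  have key' : ∀ i j, Integrable (fun ω => if i ≠ j then h (Y i ω) (Y j ω) else 0) μ ∧
      ∫ ω, (if i ≠ j then h (Y i ω) (Y j ω) else 0) ∂μ = if i ≠ j then m else 0 := by
    intro i j
    by_cases hij : i ≠ j
    · simpa [hij] using key i j hij
    · simp [hij]
  unfold uStatistic
  refine ⟨(integrable_finsetSum _ fun i _ => integrable_finsetSum _ fun j _ =>
    (key' i j).1).const_mul _, ?_⟩
  rw [integral_const_mul, integral_finsetSum _ fun i _ => integrable_finsetSum _ fun j _ =>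
    (key' i j).1]
  simp only [fun i => integral_finsetSum Finset.univ fun j _ => (key' i j).1, (key' _ _).2]
  have hs : ∀ i : Fin n, ∑ j, (if i ≠ j then m else 0) = (n - 1) * m := by
    intro i
    have : ∀ j, (if i ≠ j then m else 0) = m - if i = j then m else 0 := fun j => by
      by_cases hij : i = j <;> simp [hij]
    simp only [this, Finset.sum_sub_distrib, Finset.sum_ite_eq, Finset.mem_univ, if_true]
    simp
    ring
  simp only [hs]
  have h2 : (2 : ℝ) ≤ n := by exact_mod_cast hn
  have h0 : (n : ℝ) ≠ 0 := by positivity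
  have h1 : (n : ℝ) - 1 ≠ 0 := by linarith
  simp
  field_simp

end UStatistic

/-! ### The feature map of a kernel `k • id`. -/

section KernelFeatures

variable {X : Type*} [NormedAddCommGroup X] [InnerProductSpace ℝ X]

theorem HasBoundedMixedDeriv.clm_comp {F F' : Type*} [NormedAddCommGroup F] [NormedSpace ℝ F]
    [NormedAddCommGroup F'] [NormedSpace ℝ F'] {G : X → X → F} {G₂ : X → X → X →L[ℝ] F}
    {G₁₂ : X → X → X →L[ℝ] X →L[ℝ] F} (h : HasBoundedMixedDeriv G G₂ G₁₂) (L : F →L[ℝ] F') :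
    HasBoundedMixedDeriv (fun x y => L (G x y)) (fun x y => L ∘L G₂ x y)
      fun x y => (ContinuousLinearMap.compL ℝ X F F' L) ∘L G₁₂ x y where
  snd x y := L.hasFDerivAt.comp y (h.snd x y)
  fst x y := (ContinuousLinearMap.compL ℝ X F F' L).hasFDerivAt.comp x (h.fst x y)
  continuous := continuous_const.clm_comp h.continuous
  bounded := by
    obtain ⟨M, hM⟩ := h.bounded
    refine ⟨‖ContinuousLinearMap.compL ℝ X F F' L‖ * M, fun x y => ?_⟩
    refine (ContinuousLinearMap.opNorm_comp_le _ _).trans ?_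
    gcongr
    exact hM x y

/-- A feature map whose Gram kernel has a bounded continuous mixed derivative is continuously
differentiable with bounded derivative. -/
theorem HasBoundedMixedDeriv.exists_hasFDerivAt {V H : Type*} [NormedAddCommGroup V]
    [NormedSpace ℝ V] [NormedAddCommGroup H] [InnerProductSpace ℝ H] [CompleteSpace H]
    {Φ : X → V →L[ℝ] H} {G : X → X → V →L[ℝ] V →L[ℝ] ℝ} {G₂ : X → X → X →L[ℝ] V →L[ℝ] V →L[ℝ] ℝ}
    {G₁₂ : X → X → X →L[ℝ] X →L[ℝ] V →L[ℝ] V →L[ℝ] ℝ} (h : HasBoundedMixedDeriv G G₂ G₁₂)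
    (hG : ∀ x y u w, G x y u w = ⟪Φ x u, Φ y w⟫) :
    ∃ T : X → X →L[ℝ] V →L[ℝ] H, (∀ x, HasFDerivAt Φ (T x) x) ∧ Continuous T ∧
      (∀ x y h h' u w, ⟪T x h u, T y h' w⟫ = G₁₂ x y h h' u w) ∧ ∃ M, ∀ x, ‖T x‖ ≤ M := by
  obtain ⟨T, hT, hc, hg⟩ := exists_hasFDerivAt_of_gram hG h.snd h.fst h.continuous
  obtain ⟨M, hM⟩ := h.bounded
  refine ⟨T, hT, hc, hg, √M, fun x => ?_⟩
  refine (ContinuousLinearMap.opNorm_le_bound₂ _ (Real.sqrt_nonneg _) fun a u =>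
    norm_le_sqrt_of_norm_sq_eq (G₁₂ x x) ?_).trans (Real.sqrt_le_sqrt (hM x x))
  rw [← real_inner_self_eq_norm_sq, hg]

theorem HasScalarKernel.inner_kerFun_kerFun {X V H : Type*} [NormedAddCommGroup V]
    [InnerProductSpace ℝ V] [CompleteSpace V] [NormedAddCommGroup H] [InnerProductSpace ℝ H]
    [CompleteSpace H] [RKHS ℝ H X V] {k : X → X → ℝ} (hH : HasScalarKernel H k) (x y : X)
    (u w : V) :
    ⟪RKHS.kerFun H x u, RKHS.kerFun H y w⟫ = k x y * ⟪u, w⟫ := by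
  rw [real_inner_comm, ← RKHS.kernel_inner, hH x y, real_inner_comm]
  simp [real_inner_smul_right]

theorem exists_realInner_clm (V : Type*) [NormedAddCommGroup V] [InnerProductSpace ℝ V] :
    ∃ B : V →L[ℝ] V →L[ℝ] ℝ, ∀ u w, B u w = ⟪u, w⟫ :=
  ⟨LinearMap.mkContinuous₂ (LinearMap.mk₂ ℝ (fun u w : V => ⟪u, w⟫) inner_add_left
    (fun c u w => real_inner_smul_left u w c) inner_add_right
    (fun c u w => real_inner_smul_right u w c)) 1 fun u w => by
      simpa using norm_inner_le_norm (𝕜 := ℝ) u w, fun _ _ => rfl⟩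

variable {V H : Type*} [NormedAddCommGroup V] [InnerProductSpace ℝ V] [CompleteSpace V]
  [NormedAddCommGroup H] [InnerProductSpace ℝ H] [CompleteSpace H] [RKHS ℝ H X V] {k : X → X → ℝ}

/-- The canonical feature map of a Hilbert space of functions with kernel `k • id`,
`k ∈ C_b^{(1,1)}`, is continuously differentiable with bounded derivative. -/
theorem HasScalarKernel.exists_hasFDerivAt_kerFun (hH : HasScalarKernel H k) (hk : IsCb 1 k) :
    ∃ T : X → X →L[ℝ] V →L[ℝ] H, (∀ x, HasFDerivAt (RKHS.kerFun H) (T x) x) ∧ Continuous T ∧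
      (∀ x y h h' u w, ⟪T x h u, T y h' w⟫
        = fderiv ℝ (fun z => fderiv ℝ (k z) y) x h h' * ⟪u, w⟫) ∧
      (∀ x y h u w, ⟪T x h u, RKHS.kerFun H y w⟫ = fderiv ℝ (fun z => k z y) x h * ⟪u, w⟫) ∧
      ∃ M, ∀ x, ‖T x‖ ≤ M := by
  obtain ⟨B, hB⟩ := exists_realInner_clm V
  -- The Gram kernel of `RKHS.kerFun H` is `k x y • B` with `B` the inner product of `V`, so the
  -- mixed derivatives of `k` transfer by a fixed linear map.
  obtain ⟨T, hT, hc, hg, hM⟩ := (hk.hasBoundedMixedDeriv.clm_comp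
    (ContinuousLinearMap.toSpanSingleton ℝ B)).exists_hasFDerivAt (Φ := RKHS.kerFun H)
    (fun x y u w => by
      rw [hH.inner_kerFun_kerFun]
      simp [hB])
  refine ⟨T, hT, hc, fun x y h h' u w => ?_, fun x y h u w => ?_, hM⟩
  · rw [hg]
    simp [hB]
  · have hk₁ := ((hk.of_isometry (Nat.zero_le 1) k (continuousMultilinearCurryFin0 ℝ X ℝ).symm
      (fun x y => by rw [iteratedFDeriv_zero_eq_comp]; rfl)).1 y).differentiable (by simp) x
    have e₁ := hk₁.hasFDerivAt.mul_const ⟪u, w⟫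
    have e₂ := ((hT x).clm_apply (hasFDerivAt_const u x)).inner ℝ
      (hasFDerivAt_const (RKHS.kerFun H y w) x)
    simp only [hH.inner_kerFun_kerFun] at e₂
    have := congrArg (fun L => L h) (e₁.unique e₂)
    simp at this
    rw [mul_comm, this]
    simp

theorem HasScalarKernel.exists_norm_kerFun_le (hH : HasScalarKernel H k) (hk : IsCb 1 k) :
    ∃ M, ∀ x, ‖RKHS.kerFun H x‖ ≤ M := by
  obtain ⟨M, hM⟩ := hk.exists_bound
  refine ⟨√M, fun x => ContinuousLinearMap.opNorm_le_bound _ (Real.sqrt_nonneg _) fun v => ?_⟩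
  refine abs_le_of_sq_le_sq' ?_ (by positivity) |>.2
  have hM0 : 0 ≤ M := (abs_nonneg _).trans (hM x x)
  rw [← real_inner_self_eq_norm_sq, hH.inner_kerFun_kerFun, real_inner_self_eq_norm_sq, mul_pow,
    Real.sq_sqrt hM0]
  gcongr
  exact (le_abs_self _).trans (hM x x)

end KernelFeatures

/-! ### Scalar kernels: operators applied in each argument, and higher regularity. -/

section ScalarFeatures

variable {X : Type*} [NormedAddCommGroup X] [InnerProductSpace ℝ X]
  {H : Type*} [NormedAddCommGroup H] [InnerProductSpace ℝ H] [CompleteSpace H] [RKHS ℝ H X ℝ]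
  {k : X → X → ℝ}

theorem inner_kerFun_one {X H : Type*} [NormedAddCommGroup H] [InnerProductSpace ℝ H]
    [CompleteSpace H] [RKHS ℝ H X ℝ] (x : X) (f : H) : ⟪RKHS.kerFun H x (1 : ℝ), f⟫ = f x := by
  simp

theorem HasScalarKernel.coe_kerFun_one {X H : Type*} [NormedAddCommGroup H] [InnerProductSpace ℝ H]
    [CompleteSpace H] [RKHS ℝ H X ℝ] {k : X → X → ℝ} (hH : HasScalarKernel H k) (x : X) :
    ⇑(RKHS.kerFun H x (1 : ℝ)) = k x := by
  funext y
  rw [← inner_kerFun_one, real_inner_comm, hH.inner_kerFun_kerFun]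
  simp

/-- If `A` is represented by `ξ` on the Hilbert space `H` with kernel `k`, then applying `A` to `k`
in the second argument gives the function `ξ x'`, and `(A ⊗ A) k` is the Gram kernel of `ξ`. -/
theorem HasScalarKernel.operator_kernel_eq {X H : Type*} [NormedAddCommGroup H]
    [InnerProductSpace ℝ H] [CompleteSpace H] [RKHS ℝ H X ℝ] {k : X → X → ℝ} (hH : HasScalarKernel H k) {A : (X → ℝ) → X → ℝ}
    {ξ : X → H} (hA : ∀ (f : H) x, A f x = ⟪ξ x, f⟫) (x' : X) :
    (fun z => A (k z) x') = ξ x' := by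
  funext z
  rw [← hH.coe_kerFun_one z, hA, real_inner_comm, inner_kerFun_one]

theorem HasScalarKernel.tensorOp_eq {X H : Type*} [NormedAddCommGroup H]
    [InnerProductSpace ℝ H] [CompleteSpace H] [RKHS ℝ H X ℝ] {k : X → X → ℝ}
    (hH : HasScalarKernel H k) {A : (X → ℝ) → X → ℝ}
    {ξ : X → H} (hA : ∀ (f : H) x, A f x = ⟪ξ x, f⟫) (x x' : X) :
    tensorOp A k x x' = ⟪ξ x, ξ x'⟫ := by
  have h := hH.operator_kernel_eq hA x'
  simp only [tensorOp]
  rw [← hA, ← h]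

/-- The derivative `φ'` of the feature map `φ x = k(x, ·)` of a scalar kernel. -/
theorem HasScalarKernel.exists_hasFDerivAt_feature (hH : HasScalarKernel H k) (hk : IsCb 1 k) :
    ∃ S : X → X →L[ℝ] H, (∀ x, HasFDerivAt (fun z => RKHS.kerFun H z (1 : ℝ)) (S x) x) ∧
      Continuous S ∧
      (∀ x y h h', ⟪S x h, S y h'⟫ = fderiv ℝ (fun z => fderiv ℝ (k z) y) x h h') ∧
      (∀ x y h, ⟪S x h, RKHS.kerFun H y (1 : ℝ)⟫ = fderiv ℝ (fun z => k z y) x h) ∧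
      ∃ M, ∀ x, ‖S x‖ ≤ M := by
  obtain ⟨T, hT, hc, hg, hg', M, hM⟩ := hH.exists_hasFDerivAt_kerFun hk
  refine ⟨fun x => (T x).flip 1, fun x => ?_, ?_, fun x y h h' => ?_, fun x y h => ?_, M,
    fun x => ?_⟩
  · simpa using (hT x).clm_apply (hasFDerivAt_const (1 : ℝ) x)
  · exact ((ContinuousLinearMap.flipₗᵢ ℝ X ℝ H).continuous.comp hc).clm_apply continuous_const
  · simp [hg]
  · simpa using hg' x y h 1 1
  · refine ((T x).flip.le_opNorm 1).trans ?_
    simpa using hM x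

/-- For `k ∈ C_b^{(2,2)}` the feature map is twice continuously differentiable with bounded
derivatives. -/
theorem HasScalarKernel.exists_hasFDerivAt_feature_deriv (hH : HasScalarKernel H k)
    (hk : IsCb 2 k) :
    ∃ (S : X → X →L[ℝ] H) (T : X → X →L[ℝ] X →L[ℝ] H),
      (∀ x, HasFDerivAt (fun z => RKHS.kerFun H z (1 : ℝ)) (S x) x) ∧
      (∀ x, HasFDerivAt S (T x) x) ∧ Continuous T ∧ (∃ M, ∀ x, ‖S x‖ ≤ M) ∧
      ∃ M, ∀ x, ‖T x‖ ≤ M := by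
  obtain ⟨S, hS, -, hg, -, hM⟩ := hH.exists_hasFDerivAt_feature (hk.of_le one_le_two)
  obtain ⟨G₂, G₁₂, hG⟩ := hk.exists_hasBoundedMixedDeriv
  -- The Gram criterion is used a second time, now for `S` with directions `V = X`.
  obtain ⟨T, hT, hc, -, hM'⟩ := hG.exists_hasFDerivAt (Φ := S)
    (fun x y u w => (hg x y u w).symm)
  exact ⟨S, T, hS, hT, hc, hM, hM'⟩

end ScalarFeatures

/-! ### Integrable representers of the Stein operators. -/

section Representers

theorem integrable_of_continuous_of_bounded {X : Type*} [NormedAddCommGroup X] [MeasurableSpace X]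
    [BorelSpace X] [TopologicalSpace.SeparableSpace X] {Q : Measure X} [IsProbabilityMeasure Q]
    {W : Type*} [NormedAddCommGroup W] {f : X → W} (hf : Continuous f) {M : ℝ}
    (hM : ∀ x, ‖f x‖ ≤ M) : Integrable f Q := by
  have : SecondCountableTopology X := UniformSpace.secondCountable_of_separable X
  exact Integrable.of_bound hf.aestronglyMeasurable M (ae_of_all _ hM)

/-- Made for the drift term: `m` need only be measurable with a first moment, since `gradient U`
need not be continuous. -/
theorem integrable_clm_apply {X : Type*} [NormedAddCommGroup X] [NormedSpace ℝ X]
    [MeasurableSpace X] [BorelSpace X] [TopologicalSpace.SeparableSpace X] {Q : Measure X}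
    {W : Type*} [NormedAddCommGroup W] [NormedSpace ℝ W] {Ψ : X → X →L[ℝ] W} (hΨ : Continuous Ψ)
    {M : ℝ} (hM : ∀ x, ‖Ψ x‖ ≤ M) {m : X → X} (hm : Measurable m) (hi : Integrable m Q) :
    Integrable (fun x => Ψ x (m x)) Q := by
  have : SecondCountableTopology X := UniformSpace.secondCountable_of_separable X
  have hc : Continuous fun p : X × X => Ψ p.1 p.2 := by fun_prop
  refine (hi.norm.const_mul M).mono'
    (hc.stronglyMeasurable.comp_measurable (measurable_id.prodMk hm)).aestronglyMeasurable
    (ae_of_all _ fun x => ?_)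
  exact (Ψ x).le_of_opNorm_le (hM x) _

theorem measurable_gradient {X : Type*} [NormedAddCommGroup X] [InnerProductSpace ℝ X]
    [CompleteSpace X] [MeasurableSpace X] [BorelSpace X] (U : X → ℝ) : Measurable (gradient U) := by
  have h : gradient U = (InnerProductSpace.toDual ℝ X).symm ∘ fderiv ℝ U := rfl
  rw [h]
  borelize (StrongDual ℝ X)
  exact (InnerProductSpace.toDual ℝ X).symm.continuous.measurable.comp (measurable_fderiv ℝ U)

variable {X : Type*} [NormedAddCommGroup X] [InnerProductSpace ℝ X] [CompleteSpace X]
  [MeasurableSpace X] [BorelSpace X] [TopologicalSpace.SeparableSpace X]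
  {C : X →L[ℝ] X} {γ : Measure X} {U : X → ℝ} {P Q : Measure X}

theorem measurable_drift (C : X →L[ℝ] X) (U : X → ℝ) :
    Measurable fun x => x + C (gradient U x) := by
  have : SecondCountableTopology X := UniformSpace.secondCountable_of_separable X
  exact measurable_id.add (C.continuous.measurable.comp (measurable_gradient U))

theorem GibbsAssumptions.integrable_drift [IsProbabilityMeasure Q]
    (h : GibbsAssumptions C γ U P Q) : Integrable (fun x => x + C (gradient U x)) Q := by
  have : SecondCountableTopology X := UniformSpace.secondCountable_of_separable X
  have h₁ : Integrable (fun x : X => x) Q := by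
    have : MemLp (fun x : X => x) 2 Q :=
      (memLp_two_iff_integrable_sq_norm measurable_id.aestronglyMeasurable).2 h.sq_moment
    exact this.integrable one_le_two
  refine h₁.add ((integrable_norm_iff ?_).1 h.drift_moment)
  exact (C.continuous.measurable.comp (measurable_gradient U)).aestronglyMeasurable

variable {H : Type*} [NormedAddCommGroup H] [InnerProductSpace ℝ H]

/-- The representer `∫ Ψ'(x) g g dγ(g) - Ψ(x) (x + C DU(x))` of the Stein operator at `x`. -/
noncomputable def steinRepresenter (C : X →L[ℝ] X) (γ : Measure X) (U : X → ℝ) (Ψ : X → X →L[ℝ] H)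
    (T : X → X →L[ℝ] X →L[ℝ] H) (x : X) : H :=
  ∫ g, T x g g ∂γ - Ψ x (x + C (gradient U x))

theorem GibbsAssumptions.integrable_steinRepresenter [IsProbabilityMeasure Q]
    (h : GibbsAssumptions C γ U P Q) {Ψ : X → X →L[ℝ] H}
    {T : X → X →L[ℝ] X →L[ℝ] H} (hΨ : ∀ x, HasFDerivAt Ψ (T x) x) (hT : Continuous T)
    {M : ℝ} (hM : ∀ x, ‖Ψ x‖ ≤ M) {M' : ℝ} (hM' : ∀ x, ‖T x‖ ≤ M') :
    Integrable (steinRepresenter C γ U Ψ T) Q := by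
  obtain ⟨τ, hτ⟩ := exists_integral_apply_self_clm (H := H)
    (h.gaussian.integrable_norm_sq h.posTraceClass)
  rw [show steinRepresenter C γ U Ψ T = fun x => τ (T x) - Ψ x (x + C (gradient U x)) from
    funext fun x => by rw [steinRepresenter, hτ]]
  refine Integrable.sub (integrable_of_continuous_of_bounded (τ.continuous.comp hT) (M := ‖τ‖ * M')
    fun x => (τ.le_opNorm _).trans (by gcongr; exact hM' x)) ?_
  exact integrable_clm_apply (continuous_iff_continuousAt.2 fun x => (hΨ x).continuousAt) hM
    (measurable_drift C U) h.integrable_drift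

/-- `⟨ξ x, f⟩ = Tr[C DF(x)] - ⟨F(x), x + C DU(x)⟩` with `F = Ψ† f`. -/
theorem inner_steinRepresenter [CompleteSpace H] (hγ : IsCenteredGaussian C γ)
    (hC : IsPosTraceClass C) {Ψ : X → X →L[ℝ] H} {T : X → X →L[ℝ] X →L[ℝ] H}
    (hΨ : ∀ x, HasFDerivAt Ψ (T x) x) (f : H) (x : X) :
    ⟪steinRepresenter C γ U Ψ T x, f⟫ = vecSteinOp C U (fun z => adjointEval f (Ψ z)) x := by
  have hd : fderiv ℝ (fun z => adjointEval f (Ψ z)) x = adjointEval f ∘L T x :=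
    ((adjointEval f).hasFDerivAt.comp x (hΨ x)).fderiv
  rw [vecSteinOp, hd, hγ.opTrace_comp hC, steinRepresenter, inner_sub_left, real_inner_comm f,
    ← integral_inner (integrable_apply_self (hγ.integrable_norm_sq hC) (T x)), inner_adjointEval,
    real_inner_comm f]
  simp only [ContinuousLinearMap.comp_apply, inner_adjointEval]

/-- The sum of the representers of the components along an orthonormal basis. -/
theorem hasSum_inner_steinRepresenter [CompleteSpace H] (hγ : IsCenteredGaussian C γ)
    (hC : IsPosTraceClass C) {ι : Type*} (e : HilbertBasis ι ℝ X) (Ψ : X → X →L[ℝ] H)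
    (T : X → X →L[ℝ] X →L[ℝ] H) (f : H) (x : X) :
    HasSum (fun i => ⟪T x (C (e i)) (e i) - ⟪x + C (gradient U x), e i⟫ • Ψ x (e i), f⟫)
      ⟪steinRepresenter C γ U Ψ T x, f⟫ := by
  have h₁ := hγ.hasSum_trace_comp hC e (adjointEval f ∘L T x)
  have h₂ := e.hasSum_inner_mul_inner (x + C (gradient U x)) (adjointEval f (Ψ x))
  rw [steinRepresenter, inner_sub_left, real_inner_comm f,
    ← integral_inner (integrable_apply_self (hγ.integrable_norm_sq hC) (T x)),
    real_inner_comm f, ← inner_adjointEval, real_inner_comm _ (adjointEval f (Ψ x))]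
  simp only [ContinuousLinearMap.comp_apply, inner_adjointEval] at h₁
  refine (h₁.sub h₂).congr_fun fun i => ?_
  rw [inner_sub_left, real_inner_smul_left, real_inner_comm f, real_inner_comm f,
    real_inner_comm (adjointEval f (Ψ x)), inner_adjointEval]

end Representers

/-! ### Exchanging the series over the basis with the double expectation. -/

section SeriesExchange

variable {X H : Type*} [MeasurableSpace X] [NormedAddCommGroup H] [InnerProductSpace ℝ H]
  {Q : Measure X} {ι : Type*} [Countable ι]

/-- Termwise integration of `∑ᵢ ⟨ζᵢ(x), ζᵢ(x')⟩` when `(∑ᵢ ‖ζᵢ(x)‖²)^{1/2}` has an integrable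
majorant `w`. -/
theorem hasSum_integral_inner_prod {ζ : ι → X → H} (hζ : ∀ i, Integrable (ζ i) Q)
    {N : ι → X → ℝ} (hN : ∀ i x, ‖ζ i x‖ ^ 2 ≤ N i x) {σ w : X → ℝ}
    (hσ : ∀ x, HasSum (fun i => N i x) (σ x)) (hσm : Measurable σ) (hσw : ∀ x, σ x ≤ w x ^ 2)
    (hw : ∀ x, 0 < w x) (hwm : Measurable w) (hwi : Integrable w Q)
    {f : X × X → ℝ} (hf : ∀ p, HasSum (fun i => ⟪ζ i p.1, ζ i p.2⟫) (f p)) :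
    HasSum (fun i => ∫ p : X × X, ⟪ζ i p.1, ζ i p.2⟫ ∂(Q.prod Q)) (∫ p, f p ∂(Q.prod Q)) := by
  have hsum : ∀ p : X × X, HasSum
      (fun i => (N i p.1 * (w p.2 / w p.1) + N i p.2 * (w p.1 / w p.2)) / 2)
      ((σ p.1 * (w p.2 / w p.1) + σ p.2 * (w p.1 / w p.2)) / 2) := fun p =>
    (((hσ p.1).mul_right _).add ((hσ p.2).mul_right _)).div_const 2
  have hσ0 : ∀ x, 0 ≤ σ x := fun x => (hσ x).nonneg fun i => (sq_nonneg _).trans (hN i x)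
  refine hasSum_integral_of_dominated_convergence
    (fun i p => (N i p.1 * (w p.2 / w p.1) + N i p.2 * (w p.1 / w p.2)) / 2)
    (fun i => (integrable_inner_prod (hζ i)).1) (fun i => ae_of_all _ fun p => ?_)
    (ae_of_all _ fun p => (hsum p).summable) ?_ (ae_of_all _ hf)
  · have h₁ := hw p.1
    have h₂ := hw p.2
    calc ‖⟪ζ i p.1, ζ i p.2⟫‖ ≤ ‖ζ i p.1‖ * ‖ζ i p.2‖ := norm_inner_le_norm _ _
      -- The weights make the summed bound at most `w p.1 * w p.2`, integrable once `w` is;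
      -- unweighted AM–GM would require `σ` itself, a second moment of the drift, to be integrable.
      _ ≤ (‖ζ i p.1‖ ^ 2 * (w p.2 / w p.1) + ‖ζ i p.2‖ ^ 2 * (w p.1 / w p.2)) / 2 := by
        have h : 0 ≤ (‖ζ i p.1‖ * w p.2 - ‖ζ i p.2‖ * w p.1) ^ 2 / (w p.1 * w p.2) := by positivity
        have e : (‖ζ i p.1‖ * w p.2 - ‖ζ i p.2‖ * w p.1) ^ 2 / (w p.1 * w p.2)
            = ‖ζ i p.1‖ ^ 2 * (w p.2 / w p.1) + ‖ζ i p.2‖ ^ 2 * (w p.1 / w p.2)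
              - 2 * (‖ζ i p.1‖ * ‖ζ i p.2‖) := by
          field_simp
          ring
        linarith
      _ ≤ _ := by gcongr <;> exact hN _ _
  · simp only [fun p => (hsum p).tsum_eq]
    refine (hwi.mul_prod hwi).mono' (by fun_prop) (ae_of_all _ fun p => ?_)
    have h₁ := hw p.1
    have h₂ := hw p.2
    have g₁ := hσ0 p.1
    have g₂ := hσ0 p.2
    rw [Real.norm_of_nonneg (by positivity)]
    calc _ ≤ (w p.1 ^ 2 * (w p.2 / w p.1) + w p.2 ^ 2 * (w p.1 / w p.2)) / 2 := by
          gcongr <;> exact hσw _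
      _ = _ := by field_simp; ring

end SeriesExchange

/-! ### Derivatives and `Γᵢ` on the scalar space. -/

section ScalarDiscrepancy

variable {X : Type*} [NormedAddCommGroup X] [InnerProductSpace ℝ X]
  {H : Type*} [NormedAddCommGroup H] [InnerProductSpace ℝ H] [CompleteSpace H] [RKHS ℝ H X ℝ]
  {S : X → X →L[ℝ] H}

theorem hasFDerivAt_coe (hS : ∀ x, HasFDerivAt (fun z => RKHS.kerFun H z (1 : ℝ)) (S x) x) (f : H)
    (x : X) : HasFDerivAt f ((innerSL ℝ f) ∘L S x) x := by
  have h := (innerSL ℝ f).hasFDerivAt.comp x (hS x)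
  refine h.congr_of_eventuallyEq (Eventually.of_forall fun z => ?_)
  simp

theorem gradient_coe [CompleteSpace X]
    (hS : ∀ x, HasFDerivAt (fun z => RKHS.kerFun H z (1 : ℝ)) (S x) x) (f : H)
    (x : X) : gradient f x = adjointEval f (S x) := by
  refine ext_inner_right ℝ fun v => ?_
  rw [inner_adjointEval, ← InnerProductSpace.toDual_apply_apply (𝕜 := ℝ), toDual_gradient,
    (hasFDerivAt_coe hS f x).fderiv]
  rfl

theorem contDiff_two_coe {T : X → X →L[ℝ] X →L[ℝ] H}
    (hS : ∀ x, HasFDerivAt (fun z => RKHS.kerFun H z (1 : ℝ)) (S x) x)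
    (hT : ∀ x, HasFDerivAt S (T x) x) (hc : Continuous T) (f : H) : ContDiff ℝ 2 f := by
  have h₁ : ContDiff ℝ ((1 : ℕ) : WithTop ℕ∞) S := by
    exact_mod_cast contDiff_one_iff_hasFDerivAt.2 ⟨T, hc, hT⟩
  have h₂ : ContDiff ℝ 2 fun z => RKHS.kerFun H z (1 : ℝ) := by
    have := contDiff_succ_iff_hasFDerivAt.2 ⟨S, h₁, hS⟩
    rwa [show (((1 : ℕ) : WithTop ℕ∞) + 1) = 2 by norm_num] at this
  have h₃ : ⇑f = fun x => innerSL ℝ f (RKHS.kerFun H x (1 : ℝ)) := by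
    funext x
    simp
  rw [h₃]
  exact (innerSL ℝ f).contDiff.comp h₂

theorem gammaComp_coe [CompleteSpace X] {C : X →L[ℝ] X} (hC : C.IsPositive) (U : X → ℝ)
    (hS : ∀ x, HasFDerivAt (fun z => RKHS.kerFun H z (1 : ℝ)) (S x) x) (u : X) (f : H) (x : X) :
    gammaComp C U u f x
      = ⟪S x (C u) - ⟪x + C (gradient U x), u⟫ • RKHS.kerFun H x (1 : ℝ), f⟫ := by
  have h : ⟪C (gradient f x), u⟫ = ⟪gradient f x, C u⟫ := hC.isSymmetric _ _
  rw [gammaComp, gammaOp, inner_sub_left, h, gradient_coe hS, inner_adjointEval, inner_sub_left,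
    real_inner_smul_left, real_inner_smul_left, inner_kerFun_one, real_inner_comm f, mul_comm]

end ScalarDiscrepancy

/-! ### Factorisation of inner products for `K = k I`. -/

section VectorDiscrepancy

variable {X V : Type*} [NormedAddCommGroup V] [InnerProductSpace ℝ V] [CompleteSpace V]
  {H : Type*} [NormedAddCommGroup H] [InnerProductSpace ℝ H] [CompleteSpace H] [RKHS ℝ H X V]

theorem coe_eq_adjointEval (f : H) : ⇑f = fun z => adjointEval f (RKHS.kerFun H z) := by
  funext z
  refine ext_inner_right ℝ fun v => ?_
  rw [inner_adjointEval, RKHS.inner_kerFun]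

/-- Inner products of combinations of `Φ` and `Φ'`, where `Φ` is the feature map of a kernel
`k • id_V`, are products of an expression in `k` and the inner product of `V`. -/
theorem inner_sub_smul_sub_smul {X V H : Type*} [NormedAddCommGroup V] [InnerProductSpace ℝ V]
    [NormedAddCommGroup H] [InnerProductSpace ℝ H] {Φ : X → V →L[ℝ] H} {E : Type*}
    {T : X → E → V → H} {k : X → X → ℝ} {k₁ : X → X → E → ℝ} {k₁₂ : X → X → E → E → ℝ}
    (h₁ : ∀ x y u w, ⟪Φ x u, Φ y w⟫ = k x y * ⟪u, w⟫)
    (h₂ : ∀ x y h u w, ⟪T x h u, Φ y w⟫ = k₁ x y h * ⟪u, w⟫)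
    (h₃ : ∀ x y h h' u w, ⟪T x h u, T y h' w⟫ = k₁₂ x y h h' * ⟪u, w⟫)
    (x y : X) (h h' : E) (c c' : ℝ) (u w : V) :
    ⟪T x h u - c • Φ x u, T y h' w - c' • Φ y w⟫
      = (k₁₂ x y h h' - c' * k₁ x y h - c * k₁ y x h' + c * c' * k x y) * ⟪u, w⟫ := by
  have h₄ : ⟪Φ x u, T y h' w⟫ = k₁ y x h' * ⟪u, w⟫ := by
    rw [real_inner_comm, h₂, real_inner_comm]
  simp only [inner_sub_left, inner_sub_right, real_inner_smul_left, real_inner_smul_right, h₁, h₂,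
    h₃, h₄]
  ring

end VectorDiscrepancy

/-! ### Representers for both Stein operators. -/

section SteinDiscrepancies

variable {X : Type*} [NormedAddCommGroup X] [InnerProductSpace ℝ X] [CompleteSpace X]
  [TopologicalSpace.SeparableSpace X] [MeasurableSpace X] [BorelSpace X]
  {C : X →L[ℝ] X} {γ : Measure X} {U : X → ℝ} {P Q : Measure X} [IsProbabilityMeasure Q]
  {k : X → X → ℝ}

/-- For `k ∈ C_b^{(2,2)}` the Stein operator on the scalar Hilbert space is represented by an
integrable family. -/
theorem GibbsAssumptions.exists_representer_steinOp (h : GibbsAssumptions C γ U P Q)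
    {H : Type*} [NormedAddCommGroup H] [InnerProductSpace ℝ H] [CompleteSpace H] [RKHS ℝ H X ℝ]
    (hH : HasScalarKernel H k) (hk : IsCb 2 k) :
    (∀ f : H, ContDiff ℝ 2 f) ∧
      ∃ ξ : X → H, Integrable ξ Q ∧ ∀ (f : H) x, steinOp C U f x = ⟪ξ x, f⟫ := by
  obtain ⟨S, T, hS, hT, hc, ⟨M, hM⟩, M', hM'⟩ := hH.exists_hasFDerivAt_feature_deriv hk
  refine ⟨contDiff_two_coe hS hT hc, steinRepresenter C γ U S T,
    h.integrable_steinRepresenter hT hc hM hM', fun f x => ?_⟩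
  rw [inner_steinRepresenter h.gaussian h.posTraceClass hT,
    ← show gradient f = fun z => adjointEval f (S z) from funext (gradient_coe hS f)]
  rfl

/-- For `k ∈ C_b^{(1,1)}` the vectorised Stein operator and the components `Γᵢ` are represented by
integrable families, whose Gram kernels are related by summation over `i`. -/
theorem GibbsAssumptions.exists_representer_vecSteinOp (h : GibbsAssumptions C γ U P Q)
    {Hk : Type*} [NormedAddCommGroup Hk] [InnerProductSpace ℝ Hk] [CompleteSpace Hk]
    [RKHS ℝ Hk X ℝ] (hHk : HasScalarKernel Hk k)
    {HK : Type*} [NormedAddCommGroup HK] [InnerProductSpace ℝ HK] [CompleteSpace HK]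
    [RKHS ℝ HK X X] (hHK : HasScalarKernel HK k) (hk : IsCb 1 k)
    {ι : Type*} (e : HilbertBasis ι ℝ X) :
    (∀ F : HK, Differentiable ℝ F) ∧ (∀ f : Hk, Differentiable ℝ f) ∧
      ∃ (ξ : X → HK) (ζ : ι → X → Hk), Integrable ξ Q ∧ (∀ i, Integrable (ζ i) Q) ∧
        (∀ (F : HK) x, vecSteinOp C U F x = ⟪ξ x, F⟫) ∧
        (∀ i (f : Hk) x, gammaComp C U (e i) f x = ⟪ζ i x, f⟫) ∧
        (∀ x x', HasSum (fun i => ⟪ζ i x, ζ i x'⟫) ⟪ξ x, ξ x'⟫) ∧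
        HasSum (fun i => ∫ p : X × X, ⟪ζ i p.1, ζ i p.2⟫ ∂(Q.prod Q))
          (∫ p : X × X, ⟪ξ p.1, ξ p.2⟫ ∂(Q.prod Q)) := by
  have hcount := e.countable
  have hsep : SecondCountableTopology X := UniformSpace.secondCountable_of_separable X
  obtain ⟨T, hT, hTc, hTT, hTΦ, M', hM'⟩ := hHK.exists_hasFDerivAt_kerFun hk
  obtain ⟨S, hS, hSc, hSS, hSφ, L', hL'⟩ := hHk.exists_hasFDerivAt_feature hk
  obtain ⟨M, hM⟩ := hHK.exists_norm_kerFun_le hk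
  obtain ⟨L, hL⟩ := hHk.exists_norm_kerFun_le hk
  set m : X → X := fun x => x + C (gradient U x) with hm
  have hmm : Measurable m := measurable_drift C U
  have hmi : Integrable m Q := h.integrable_drift
  have hφ : ∀ x, ‖RKHS.kerFun Hk x (1 : ℝ)‖ ≤ L := fun x => by
    simpa using (RKHS.kerFun Hk x).le_of_opNorm_le (hL x) (1 : ℝ)
  have hφc : Continuous fun x => RKHS.kerFun Hk x (1 : ℝ) :=
    continuous_iff_continuousAt.2 fun x => (hS x).continuousAt
  set ξ := steinRepresenter C γ U (RKHS.kerFun HK) T with hξ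
  set ζ : ι → X → Hk := fun i x => S x (C (e i)) - ⟪m x, e i⟫ • RKHS.kerFun Hk x (1 : ℝ) with hζ
  have hζi : ∀ i, Integrable (ζ i) Q := by
    intro i
    refine Integrable.sub (integrable_of_continuous_of_bounded (hSc.clm_apply continuous_const)
      (M := L' * ‖C (e i)‖) fun x => (S x).le_of_opNorm_le (hL' x) _) ?_
    refine (integrable_clm_apply
      (Ψ := fun x => (innerSL ℝ (e i)).smulRight (RKHS.kerFun Hk x (1 : ℝ)))
      ?_ (M := ‖innerSL ℝ (e i)‖ * L) (fun x => ?_) hmm hmi).congr (ae_of_all _ fun x => ?_)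
    · exact ((ContinuousLinearMap.smulRightL ℝ X Hk) (innerSL ℝ (e i))).continuous.comp hφc
    · rw [ContinuousLinearMap.norm_smulRight_apply]
      gcongr
      exact hφ x
    · simp [real_inner_comm]
  -- Both arguments of `⟪ξ x, ξ x'⟫` are expanded along `e`. The `(i, j)` term is a scalar times `⟪e
  -- i, e j⟫`, so the inner sum collapses to `j = i`, where the scalar is the Gram kernel of `ζ i`.
  have gram : ∀ x x', HasSum (fun i => ⟪ζ i x, ζ i x'⟫) ⟪ξ x, ξ x'⟫ := by
    intro x x'
    have h₁ := hasSum_inner_steinRepresenter (U := U) h.gaussian h.posTraceClass e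
      (RKHS.kerFun HK) T (ξ x') x
    refine h₁.congr_fun fun i => ?_
    have h₂ := hasSum_inner_steinRepresenter (U := U) h.gaussian h.posTraceClass e
      (RKHS.kerFun HK) T (T x (C (e i)) (e i) - ⟪m x, e i⟫ • RKHS.kerFun HK x (e i)) x'
    refine Eq.trans ?_ (h₂.tsum_eq.trans (real_inner_comm _ _))
    simp only [inner_sub_smul_sub_smul hHK.inner_kerFun_kerFun hTΦ hTT]
    rw [tsum_eq_single i fun j hj => by rw [e.orthonormal.2 hj, mul_zero],
      real_inner_self_eq_norm_sq, e.orthonormal.1, real_inner_comm]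
    have h₃ := inner_sub_smul_sub_smul (Φ := RKHS.kerFun Hk) (T := fun x h u => u • S x h)
      (k₁ := fun x y h => fderiv ℝ (fun z => k z y) x h)
      (k₁₂ := fun x y h h' => fderiv ℝ (fun z => fderiv ℝ (k z) y) x h h')
      hHk.inner_kerFun_kerFun (fun x y h u w => ?_) (fun x y h h' u w => ?_)
      x' x (C (e i)) (C (e i)) ⟪m x', e i⟫ ⟪m x, e i⟫ 1 1
    · simpa [hζ] using h₃
    · rw [← mul_one w, ← smul_eq_mul w, map_smul, real_inner_smul_left, real_inner_smul_right, hSφ]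
      simp
      ring
    · rw [real_inner_smul_left, real_inner_smul_right, hSS]
      simp
      ring
  refine ⟨fun F => ?_, fun f x => (hasFDerivAt_coe hS f x).differentiableAt, ξ, ζ,
    h.integrable_steinRepresenter hT hTc hM hM', hζi, fun F x => ?_,
    fun i f x => gammaComp_coe h.posTraceClass.isPositive U hS (e i) f x, gram, ?_⟩
  · rw [coe_eq_adjointEval F]
    exact fun x => ((adjointEval F).hasFDerivAt.comp x (hT x)).differentiableAt
  · rw [inner_steinRepresenter h.gaussian h.posTraceClass hT, ← coe_eq_adjointEval F]
  · have hs : Summable fun i => ‖C (e i)‖ ^ 2 := by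
      refine (h.gaussian.hasSum_trace h.posTraceClass e C).summable.congr fun i => ?_
      rw [← real_inner_self_eq_norm_sq]
      exact h.posTraceClass.isPositive.isSymmetric _ _
    set s := ∑' i, ‖C (e i)‖ ^ 2
    have hs0 : 0 ≤ s := tsum_nonneg fun i => by positivity
    -- The constant comes from `(a + b) ^ 2 ≤ 2 * (a ^ 2 + b ^ 2)` and the bounds `L'`, `L` on the
    -- feature derivative and the feature. In `w` the added ones ensure `0 < w` and `R ≤ (1 + R) ^
    -- 2`.
    set R := 2 * (L' ^ 2 + L ^ 2)
    have hR0 : 0 ≤ R := by positivity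
    refine hasSum_integral_inner_prod hζi (N := fun i x => R * (‖C (e i)‖ ^ 2 + ⟪e i, m x⟫ ^ 2))
      (σ := fun x => R * (s + ‖m x‖ ^ 2)) (w := fun x => (1 + R) * (1 + s + ‖m x‖))
      (fun i x => ?_) (fun x => (hs.hasSum.add (e.hasSum_inner_sq (m x))).mul_left R)
      (by fun_prop) (fun x => ?_) (fun x => by positivity) (by fun_prop)
      (((integrable_const _).add hmi.norm).const_mul _) fun p => gram p.1 p.2
    · have h₁ : ‖ζ i x‖ ≤ L' * ‖C (e i)‖ + |⟪e i, m x⟫| * L := by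
        refine (norm_sub_le _ _).trans (add_le_add ((S x).le_of_opNorm_le (hL' x) _) ?_)
        rw [norm_smul, Real.norm_eq_abs, real_inner_comm]
        gcongr
        exact hφ x
      calc ‖ζ i x‖ ^ 2 ≤ (L' * ‖C (e i)‖ + |⟪e i, m x⟫| * L) ^ 2 := by gcongr
        _ ≤ 2 * ((L' * ‖C (e i)‖) ^ 2 + (|⟪e i, m x⟫| * L) ^ 2) := add_sq_le
        _ = 2 * (L' ^ 2 * ‖C (e i)‖ ^ 2 + L ^ 2 * ⟪e i, m x⟫ ^ 2) := by
          rw [mul_pow, mul_pow, sq_abs]; ring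
        _ ≤ _ := by
          simp only [R]
          nlinarith [mul_nonneg (sq_nonneg L) (sq_nonneg ‖C (e i)‖),
            mul_nonneg (sq_nonneg L') (sq_nonneg ⟪e i, m x⟫)]
    · rw [mul_pow]
      have h₁ : s + ‖m x‖ ^ 2 ≤ (1 + s + ‖m x‖) ^ 2 := by
        nlinarith [norm_nonneg (m x), mul_nonneg hs0 (norm_nonneg (m x))]
      have h₂ : R ≤ (1 + R) ^ 2 := by nlinarith
      gcongr

end SteinDiscrepancies

end

/-- Double-expectation formulae for the non-vectorised and the vectorised kernel Stein discrepancy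
on a separable Hilbert space. In each case the first conjuncts record that the quantities involved
are well defined, and the last one that the corresponding `U`-statistic of an i.i.d. sample from
`Q` is an unbiased estimator of the squared discrepancy. -/
theorem theorem2 {X : Type*} [NormedAddCommGroup X] [InnerProductSpace ℝ X] [CompleteSpace X]
    [TopologicalSpace.SeparableSpace X] [MeasurableSpace X] [BorelSpace X]
    (C : X →L[ℝ] X) (γ : Measure X) (U : X → ℝ)
    (P Q : Measure X) [IsProbabilityMeasure P] [IsProbabilityMeasure Q]
    (hPQ : GibbsAssumptions C γ U P Q)
    (k : X → X → ℝ)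
    {Hk : Type*} [NormedAddCommGroup Hk] [InnerProductSpace ℝ Hk] [CompleteSpace Hk]
    [RKHS ℝ Hk X ℝ] (hHk : HasScalarKernel Hk k)
    {HK : Type*} [NormedAddCommGroup HK] [InnerProductSpace ℝ HK] [CompleteSpace HK]
    [RKHS ℝ HK X X] (hHK : HasScalarKernel HK k)
    {ι : Type*} (e : HilbertBasis ι ℝ X) :
    (IsCb 2 k →
      (∀ f : Hk, ContDiff ℝ 2 f ∧ Integrable (steinOp C U f) Q) ∧
      (∀ x', ContDiff ℝ 2 fun z => steinOp C U (k z) x') ∧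
      Integrable (fun p : X × X => tensorOp (steinOp C U) k p.1 p.2) (Q.prod Q) ∧
      ksd Hk (steinOp C U) Q ≠ ∞ ∧
      (ksd Hk (steinOp C U) Q).toReal ^ 2
        = ∫ p : X × X, tensorOp (steinOp C U) k p.1 p.2 ∂(Q.prod Q) ∧
      ∀ {Ω : Type*} [MeasurableSpace Ω] (μ : Measure Ω) [IsProbabilityMeasure μ] {n : ℕ}
        (Y : Fin n → Ω → X), 2 ≤ n → IsIIDSample μ Y Q →
        Integrable (uStatistic (tensorOp (steinOp C U) k) Y) μ ∧
        ∫ ω, uStatistic (tensorOp (steinOp C U) k) Y ω ∂μ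
          = (ksd Hk (steinOp C U) Q).toReal ^ 2) ∧
    (IsCb 1 k →
      (∀ F : HK, Differentiable ℝ F ∧ Integrable (vecSteinOp C U F) Q) ∧
      (∀ i x', Differentiable ℝ fun z => gammaComp C U (e i) (k z) x') ∧
      (∀ i, Integrable (fun p : X × X => tensorOp (gammaComp C U (e i)) k p.1 p.2) (Q.prod Q)) ∧
      ksd HK (vecSteinOp C U) Q ≠ ∞ ∧
      HasSum (fun i => ∫ p : X × X, tensorOp (gammaComp C U (e i)) k p.1 p.2 ∂(Q.prod Q))
        ((ksd HK (vecSteinOp C U) Q).toReal ^ 2) ∧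
      (∀ x x', Summable fun i => tensorOp (gammaComp C U (e i)) k x x') ∧
      ∀ {Ω : Type*} [MeasurableSpace Ω] (μ : Measure Ω) [IsProbabilityMeasure μ] {n : ℕ}
        (Y : Fin n → Ω → X), 2 ≤ n → IsIIDSample μ Y Q →
        Integrable (uStatistic (fun x x' => ∑' i, tensorOp (gammaComp C U (e i)) k x x') Y) μ ∧
        ∫ ω, uStatistic (fun x x' => ∑' i, tensorOp (gammaComp C U (e i)) k x x') Y ω ∂μ
          = (ksd HK (vecSteinOp C U) Q).toReal ^ 2) := by
  refine ⟨fun hk => ?_, fun hk => ?_⟩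
  · obtain ⟨hf, ξ, hξ, hA⟩ := hPQ.exists_representer_steinOp hHk hk
    have hint : Integrable (fun p : X × X => tensorOp (steinOp C U) k p.1 p.2) (Q.prod Q) := by
      simp only [hHk.tensorOp_eq hA]
      exact integrable_inner_prod hξ
    have hksd : (ksd Hk (steinOp C U) Q).toReal ^ 2
        = ∫ p : X × X, tensorOp (steinOp C U) k p.1 p.2 ∂(Q.prod Q) := by
      simp only [hHk.tensorOp_eq hA]
      rw [integral_inner_prod hξ, ksd_eq_norm hξ hA, ENNReal.toReal_ofReal (norm_nonneg _)]
    refine ⟨fun f => ⟨hf f, integrable_of_representer hξ hA f⟩, fun x' => ?_, hint, ?_, hksd, ?_⟩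
    · rw [hHk.operator_kernel_eq hA x']
      exact hf _
    · rw [ksd_eq_norm hξ hA]
      exact ENNReal.ofReal_ne_top
    · intro Ω _ μ _ n Y hn hY
      rw [hksd]
      exact hY.integral_uStatistic hint hn
  · obtain ⟨hF, hf, ξ, ζ, hξ, hζ, hA, hΓ, hgram, hsum⟩ :=
      hPQ.exists_representer_vecSteinOp hHk hHK hk e
    have hT : ∀ i x x', tensorOp (gammaComp C U (e i)) k x x' = ⟪ζ i x, ζ i x'⟫ := fun i =>
      hHk.tensorOp_eq (hΓ i)
    have hksd : (ksd HK (vecSteinOp C U) Q).toReal ^ 2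
        = ∫ p : X × X, ⟪ξ p.1, ξ p.2⟫ ∂(Q.prod Q) := by
      rw [integral_inner_prod hξ, ksd_eq_norm hξ hA, ENNReal.toReal_ofReal (norm_nonneg _)]
    rw [hksd]
    simp only [hT, (hgram _ _).tsum_eq]
    refine ⟨fun F => ⟨hF F, integrable_of_representer hξ hA F⟩, fun i x' => ?_,
      fun i => integrable_inner_prod (hζ i), ?_, hsum, fun x x' => (hgram x x').summable, ?_⟩
    · rw [hHk.operator_kernel_eq (hΓ i) x']
      exact hf _
    · rw [ksd_eq_norm hξ hA]
      exact ENNReal.ofReal_ne_top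
    · intro Ω _ μ _ n Y hn hY
      exact hY.integral_uStatistic (integrable_inner_prod hξ) hn
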